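/- Let $(M,\xi)$ be a connected cooriented contact manifold (without boundary) of dimension $2n+1$ and let $\alpha$ be a contact form for $\xi$ inducing the coorientation. Let $\widetilde{\mathrm{Cont}}_0(M,\xi)$ be the universal cover of the identity component $\mathrm{Cont}_0(M,\xi)$ of the group of compactly supported contactomorphisms, i.e. the group of smooth compactly supported contact isotopies $(\phi_t)_{t\in[0,1]}$ with $\phi_0=\mathrm{id}_M$ modulo homotopy relative to the endpoints, and let $\pi([\phi_t])=\phi_1$. The Hamiltonian of $(\phi_t)$ is $H_t=\alpha(X_t)$, where $\frac{d}{dt}\phi_t=X_t\circ\phi_t$; write $(\phi^H_t)$ for the isotopy with Hamiltonian $H$. For $f_0,f_1\in\widetilde{\mathrm{Cont}}_0(M,\xi)$ put $$\widetilde\delta^-_\alpha(f_0,f_1)=\inf\{\varepsilon\in\mathbb R\mid \exists\, H_t:M\to[-\varepsilon,\infty)\ (t\in[0,1]) \text{ with } [\phi^H_t]\,f_0=f_1\},$$ $$\widetilde\delta^+_\alpha(f_0,f_1)=\inf\{\varepsilon\in\mathbb R\mid \exists\, H_t:M\to(-\infty,\varepsilon]\ (t\in[0,1]) \text{ with } [\phi^H_t]\,f_0=f_1\},$$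 $$\widetilde d_\alpha(f_0,f_1)=\max\{\widetilde\delta^-_\alpha(f_0,f_1),\widetilde\delta^+_\alpha(f_0,f_1),0\}.$$ Then $\widetilde d_\alpha$ is a pseudo-metric: it takes values in $[0,\infty)$, $\widetilde d_\alpha(f,f)=0$ for all $f$, and for all $f_0,f_1,f_2\in\widetilde{\mathrm{Cont}}_0(M,\xi)$: (i) (triangle inequality) $\widetilde d_\alpha(f_0,f_2)\le\widetilde d_\alpha(f_0,f_1)+\widetilde d_\alpha(f_1,f_2)$; (ii) (symmetry) $\widetilde d_\alpha(f_0,f_1)=\widetilde d_\alpha(f_1,f_0)$. Moreover, for all $f_0,f_1,f_2\in\widetilde{\mathrm{Cont}}_0(M,\xi)$: (iii) (left naturality) $\widetilde d_\alpha(f_2f_0,f_2f_1)=\widetilde d_{\pi(f_2)^*\alpha}(f_0,f_1)$; (iv) (inverse) $\widetilde d_\alpha(f_0^{-1},\mathrm{id}_M)=\widetilde d_\alpha(f_0,\mathrm{id}_M)$; (v) (right invariance) $\widetilde d_\alpha(f_0f_2,f_1f_2)=\widetilde d_\alpha(f_0,f_1)$. (vi) (topology) Suppose in addition that $M$ is compact.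 Write $f\prec g$ if $[\phi^H_t]\,f=g$ for some $H_t:M\to(0,\infty)$, $t\in[0,1]$, and $I^{\prec}_{f_0,f_1}=\{f\mid f_0\prec f\prec f_1\}$; the interval topology is the topology generated by all the sets $I^{\prec}_{f_0,f_1}$. Then the topology of the pseudo-metric $\widetilde d_\alpha$ equals the interval topology. Furthermore, for every $f\in\widetilde{\mathrm{Cont}}_0(M,\xi)$ and every $\varepsilon>0$, $$\{g\mid\widetilde d_\alpha(f,g)<\varepsilon\}=I^{\prec}_{f^\alpha_{-\varepsilon}f,\;f^\alpha_{\varepsilon}f},$$ where $f^\alpha_t=[s\mapsto\phi^\alpha_{st}]$, $s\in[0,1]$, is the lift of the time-$t$ map of the Reeb flow $(\phi^\alpha_t)$ of $\alpha$. -/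

import Mathlib

open scoped Manifold ContDiff

namespace ContactMetric

/-! Manifolds are modelled on a normed space `E` (without boundary); in the theorem `E = ℝ^(2n+1)`.
A 1-form is a family of linear functionals on the tangent spaces, a hyperplane field is a family
of subspaces of the tangent spaces. -/

section Forms

variable {E : Type*} [NormedAddCommGroup E] [NormedSpace ℝ E]
  {M : Type*} [TopologicalSpace M] [ChartedSpace E M]

/-- The 1-form `α` read in the chart at `x₀`, i.e. its pullback under the inverse chart. -/
noncomputable def formInChart (α : ∀ x : M, TangentSpace 𝓘(ℝ, E) x →L[ℝ] ℝ) (x₀ : M) :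
    E → E →L[ℝ] ℝ := fun y =>
  (α ((extChartAt 𝓘(ℝ, E) x₀).symm y)).comp
    (mfderiv 𝓘(ℝ, E) 𝓘(ℝ, E) (extChartAt 𝓘(ℝ, E) x₀).symm y)

/-- The exterior derivative of a 1-form at `x`, computed in the chart at `x`:
`dα (v, w) = (D_v a) w - (D_w a) v`, where `a` is `α` in the chart. -/
noncomputable def extDerivForm (α : ∀ x : M, TangentSpace 𝓘(ℝ, E) x →L[ℝ] ℝ) (x : M)
    (v w : TangentSpace 𝓘(ℝ, E) x) : ℝ :=
  let v' : E := mfderiv 𝓘(ℝ, E) 𝓘(ℝ, E) (extChartAt 𝓘(ℝ, E) x) x v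
  let w' : E := mfderiv 𝓘(ℝ, E) 𝓘(ℝ, E) (extChartAt 𝓘(ℝ, E) x) x w
  fderiv ℝ (formInChart α x) (extChartAt 𝓘(ℝ, E) x x) v' w' -
    fderiv ℝ (formInChart α x) (extChartAt 𝓘(ℝ, E) x x) w' v'

/-- `α` is a contact form for `ξ`: a smooth nowhere vanishing 1-form with `ker α = ξ` such that
`dα` is nondegenerate on `ξ` (equivalently `α ∧ (dα)^n` vanishes nowhere, `dim M = 2n+1`).
In particular `ξ` is a contact structure, and `α` induces a coorientation of it. -/
structure IsContactForm [IsManifold 𝓘(ℝ, E) ∞ M]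
    (ξ : ∀ x : M, Submodule ℝ (TangentSpace 𝓘(ℝ, E) x))
    (α : ∀ x : M, TangentSpace 𝓘(ℝ, E) x →L[ℝ] ℝ) : Prop where
  smooth : ContMDiff (𝓘(ℝ, E).tangent) 𝓘(ℝ, ℝ) ∞
    (fun v : TangentBundle 𝓘(ℝ, E) M => α v.proj v.snd)
  ne_zero : ∀ x, α x ≠ 0
  mem_iff : ∀ x (v : TangentSpace 𝓘(ℝ, E) x), v ∈ ξ x ↔ α x v = 0
  nondegenerate : ∀ x, ∀ v ∈ ξ x, (∀ w ∈ ξ x, extDerivForm α x v w = 0) → v = 0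

/-- `X` is the Reeb vector field of `α`: `α(X) = 1` and `dα(X, ·) = 0`. -/
def IsReebField (α : ∀ x : M, TangentSpace 𝓘(ℝ, E) x →L[ℝ] ℝ)
    (X : ∀ x : M, TangentSpace 𝓘(ℝ, E) x) : Prop :=
  ∀ x, α x (X x) = 1 ∧ ∀ v, extDerivForm α x (X x) v = 0

/-- The pullback `φ^* α` of a 1-form. -/
noncomputable def pullbackForm (φ : M → M) (α : ∀ x : M, TangentSpace 𝓘(ℝ, E) x →L[ℝ] ℝ) :
    ∀ x : M, TangentSpace 𝓘(ℝ, E) x →L[ℝ] ℝ :=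
  fun x => (α (φ x)).comp (mfderiv 𝓘(ℝ, E) 𝓘(ℝ, E) φ x)

end Forms

section Isotopies

variable {E : Type*} [NormedAddCommGroup E] [NormedSpace ℝ E]
  {M : Type*} [TopologicalSpace M] [ChartedSpace E M]

/-- A smooth family, parametrized by the vector space `P`, of contactomorphisms of `(M, ξ)` with
supports in a common compact set. -/
@[ext]
structure ContactFamily (ξ : ∀ x : M, Submodule ℝ (TangentSpace 𝓘(ℝ, E) x))
    (P : Type*) [NormedAddCommGroup P] [NormedSpace ℝ P] where
  toFun : P → M → M
  invFun : P → M → M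
  left_inv : ∀ p x, invFun p (toFun p x) = x
  right_inv : ∀ p x, toFun p (invFun p x) = x
  smooth_toFun : ContMDiff (𝓘(ℝ, P).prod 𝓘(ℝ, E)) 𝓘(ℝ, E) ∞ (fun q : P × M => toFun q.1 q.2)
  smooth_invFun : ContMDiff (𝓘(ℝ, P).prod 𝓘(ℝ, E)) 𝓘(ℝ, E) ∞ (fun q : P × M => invFun q.1 q.2)
  contact : ∀ p x (v : TangentSpace 𝓘(ℝ, E) x),
    mfderiv 𝓘(ℝ, E) 𝓘(ℝ, E) (toFun p) x v ∈ ξ (toFun p x) ↔ v ∈ ξ x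
  compact_support : ∃ K : Set M, IsCompact K ∧ ∀ p, ∀ x ∉ K, toFun p x = x

namespace ContactFamily

variable {ξ : ∀ x : M, Submodule ℝ (TangentSpace 𝓘(ℝ, E) x)}
  {P : Type*} [NormedAddCommGroup P] [NormedSpace ℝ P]

theorem smooth_toFun_apply (φ : ContactFamily ξ P) (p : P) :
    ContMDiff 𝓘(ℝ, E) 𝓘(ℝ, E) ∞ (φ.toFun p) :=
  φ.smooth_toFun.comp (contMDiff_const.prodMk contMDiff_id)

theorem smooth_invFun_apply (φ : ContactFamily ξ P) (p : P) :
    ContMDiff 𝓘(ℝ, E) 𝓘(ℝ, E) ∞ (φ.invFun p) :=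
  φ.smooth_invFun.comp (contMDiff_const.prodMk contMDiff_id)

theorem mfderiv_toFun_invFun (φ : ContactFamily ξ P) (p : P) (x : M)
    (v : TangentSpace 𝓘(ℝ, E) x) :
    mfderiv 𝓘(ℝ, E) 𝓘(ℝ, E) (φ.toFun p) (φ.invFun p x)
      (mfderiv 𝓘(ℝ, E) 𝓘(ℝ, E) (φ.invFun p) x v) = v := by
  have h := mfderiv_comp_apply (I := 𝓘(ℝ, E)) (I' := 𝓘(ℝ, E)) (I'' := 𝓘(ℝ, E)) x
    ((φ.smooth_toFun_apply p).mdifferentiable (by simp) (φ.invFun p x))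
    ((φ.smooth_invFun_apply p).mdifferentiable (by simp) x) v
  have hid : φ.toFun p ∘ φ.invFun p = id := funext (φ.right_inv p)
  rw [← h, hid, mfderiv_id]
  rfl

/-- The pointwise composition `(φ ψ)_p = φ_p ∘ ψ_p`. -/
noncomputable instance : Mul (ContactFamily ξ P) where
  mul φ ψ :=
    { toFun := fun p x => φ.toFun p (ψ.toFun p x)
      invFun := fun p x => ψ.invFun p (φ.invFun p x)
      left_inv := fun p x => by rw [φ.left_inv, ψ.left_inv]
      right_inv := fun p x => by rw [ψ.right_inv, φ.right_inv]
      smooth_toFun := φ.smooth_toFun.comp (contMDiff_fst.prodMk ψ.smooth_toFun)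
      smooth_invFun := ψ.smooth_invFun.comp (contMDiff_fst.prodMk φ.smooth_invFun)
      contact := fun p x v => by
        have h := mfderiv_comp_apply (I := 𝓘(ℝ, E)) (I' := 𝓘(ℝ, E)) (I'' := 𝓘(ℝ, E)) x
          ((φ.smooth_toFun_apply p).mdifferentiable (by simp) (ψ.toFun p x))
          ((ψ.smooth_toFun_apply p).mdifferentiable (by simp) x) v
        change mfderiv 𝓘(ℝ, E) 𝓘(ℝ, E) (φ.toFun p ∘ ψ.toFun p) x v ∈ _ ↔ _
        rw [h]
        exact (φ.contact p _ _).trans (ψ.contact p x v)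
      compact_support := by
        obtain ⟨K, hK, h⟩ := φ.compact_support
        obtain ⟨L, hL, h'⟩ := ψ.compact_support
        refine ⟨K ∪ L, hK.union hL, fun p x hx => ?_⟩
        rw [h' p x (fun hx' => hx (Or.inr hx')), h p x (fun hx' => hx (Or.inl hx'))] }

noncomputable instance : One (ContactFamily ξ P) where
  one :=
    { toFun := fun _ x => x
      invFun := fun _ x => x
      left_inv := fun _ _ => rfl
      right_inv := fun _ _ => rfl
      smooth_toFun := contMDiff_snd
      smooth_invFun := contMDiff_snd
      contact := fun _ x v => by
        change mfderiv 𝓘(ℝ, E) 𝓘(ℝ, E) (id : M → M) x v ∈ _ ↔ _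
        rw [mfderiv_id]
        rfl
      compact_support := ⟨∅, isCompact_empty, fun _ _ _ => rfl⟩ }

/-- The pointwise inverse `(φ⁻¹)_p = (φ_p)⁻¹`. -/
noncomputable instance : Inv (ContactFamily ξ P) where
  inv φ :=
    { toFun := φ.invFun
      invFun := φ.toFun
      left_inv := φ.right_inv
      right_inv := φ.left_inv
      smooth_toFun := φ.smooth_invFun
      smooth_invFun := φ.smooth_toFun
      contact := fun p x v => by
        have h := φ.contact p (φ.invFun p x) (mfderiv 𝓘(ℝ, E) 𝓘(ℝ, E) (φ.invFun p) x v)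
        rw [mfderiv_toFun_invFun, φ.right_inv] at h
        exact h.symm
      compact_support := by
        obtain ⟨K, hK, h⟩ := φ.compact_support
        refine ⟨K, hK, fun p x hx => ?_⟩
        conv_lhs => rw [← h p x hx]
        exact φ.left_inv p x }

end ContactFamily

/-- A compactly supported contact isotopy `(φ_t)` of `(M, ξ)` starting at the identity. Only the
times `t ∈ [0,1]` matter below; smoothness on `[0,1]` means that the isotopy extends smoothly
to all times. -/
@[ext]
structure ContactIsotopy (ξ : ∀ x : M, Submodule ℝ (TangentSpace 𝓘(ℝ, E) x))
    extends ContactFamily ξ ℝ where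
  map_zero : ∀ x, toFun 0 x = x

namespace ContactIsotopy

variable {ξ : ∀ x : M, Submodule ℝ (TangentSpace 𝓘(ℝ, E) x)}

noncomputable instance : Mul (ContactIsotopy ξ) where
  mul φ ψ :=
    { toContactFamily := φ.toContactFamily * ψ.toContactFamily
      map_zero := fun x => by
        change φ.toFun 0 (ψ.toFun 0 x) = x
        rw [ψ.map_zero, φ.map_zero] }

noncomputable instance : One (ContactIsotopy ξ) where
  one := { toContactFamily := 1, map_zero := fun _ => rfl }

noncomputable instance : Inv (ContactIsotopy ξ) where
  inv φ :=
    { toContactFamily := φ.toContactFamily⁻¹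
      map_zero := fun x => by
        change φ.invFun 0 x = x
        conv_lhs => rw [← φ.map_zero x]
        exact φ.left_inv 0 x }

noncomputable instance : Group (ContactIsotopy ξ) :=
  Group.ofLeftAxioms (fun _ _ _ => rfl) (fun _ => rfl) (fun φ => by
    ext p x
    · exact φ.left_inv p x
    · exact φ.left_inv p x)

/-- Homotopy, relative to the endpoints, of contact isotopies `(φ_t)`, `(ψ_t)`, `t ∈ [0,1]`, through
compactly supported contact isotopies `t ↦ Φ (s, t)`, `s ∈ [0,1]`. -/
def Homotopic (φ ψ : ContactIsotopy ξ) : Prop :=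
  ∃ Φ : ContactFamily ξ (ℝ × ℝ),
    (∀ s ∈ Set.Icc (0 : ℝ) 1, ∀ x, Φ.toFun (s, 0) x = x) ∧
    (∀ s ∈ Set.Icc (0 : ℝ) 1, ∀ x, Φ.toFun (s, 1) x = φ.toFun 1 x) ∧
    (∀ t ∈ Set.Icc (0 : ℝ) 1, ∀ x, Φ.toFun (0, t) x = φ.toFun t x) ∧
    (∀ t ∈ Set.Icc (0 : ℝ) 1, ∀ x, Φ.toFun (1, t) x = ψ.toFun t x)

theorem Homotopic.toFun_one {φ ψ : ContactIsotopy ξ} (h : Homotopic φ ψ) (x : M) :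
    φ.toFun 1 x = ψ.toFun 1 x := by
  obtain ⟨Φ, -, h1, -, h3⟩ := h
  rw [← h1 1 (by simp) x, h3 1 (by simp) x]

/-- `φ` as a constant-in-`s` family `(s, t) ↦ φ_t`. -/
noncomputable def constFamily (φ : ContactIsotopy ξ) : ContactFamily ξ (ℝ × ℝ) where
  toFun p := φ.toFun p.2
  invFun p := φ.invFun p.2
  left_inv p := φ.left_inv p.2
  right_inv p := φ.right_inv p.2
  smooth_toFun := φ.smooth_toFun.comp
    ((contDiff_snd.contMDiff.comp contMDiff_fst).prodMk contMDiff_snd)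
  smooth_invFun := φ.smooth_invFun.comp
    ((contDiff_snd.contMDiff.comp contMDiff_fst).prodMk contMDiff_snd)
  contact p := φ.contact p.2
  compact_support := by
    obtain ⟨K, hK, h⟩ := φ.compact_support
    exact ⟨K, hK, fun p => h p.2⟩

theorem Homotopic.mul_left (θ : ContactIsotopy ξ) {φ ψ : ContactIsotopy ξ}
    (h : Homotopic φ ψ) : Homotopic (θ * φ) (θ * ψ) := by
  obtain ⟨Φ, h0, h1, h2, h3⟩ := h
  refine ⟨θ.constFamily * Φ, fun s hs x => ?_, fun s hs x => ?_, fun t ht x => ?_,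
    fun t ht x => ?_⟩
  · change θ.toFun 0 (Φ.toFun (s, 0) x) = x
    rw [h0 s hs, θ.map_zero]
  · exact congrArg (θ.toFun 1) (h1 s hs x)
  · exact congrArg (θ.toFun t) (h2 t ht x)
  · exact congrArg (θ.toFun t) (h3 t ht x)

theorem Homotopic.mul_right (θ : ContactIsotopy ξ) {φ ψ : ContactIsotopy ξ}
    (h : Homotopic φ ψ) : Homotopic (φ * θ) (ψ * θ) := by
  obtain ⟨Φ, h0, h1, h2, h3⟩ := h
  refine ⟨Φ * θ.constFamily, fun s hs x => ?_, fun s hs x => ?_, fun t ht x => ?_,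
    fun t ht x => ?_⟩
  · change Φ.toFun (s, 0) (θ.toFun 0 x) = x
    rw [h0 s hs, θ.map_zero]
  · exact h1 s hs (θ.toFun 1 x)
  · exact h2 t ht (θ.toFun t x)
  · exact h3 t ht (θ.toFun t x)

theorem inv_eq_of_toFun_eq {P Q : Type*} [NormedAddCommGroup P] [NormedSpace ℝ P]
    [NormedAddCommGroup Q] [NormedSpace ℝ Q] (Φ : ContactFamily ξ P) (Ψ : ContactFamily ξ Q)
    {p : P} {q : Q} (h : ∀ x, Φ.toFun p x = Ψ.toFun q x) (x : M) :
    Φ.invFun p x = Ψ.invFun q x := by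
  conv_lhs => rw [← Ψ.right_inv q x, ← h, Φ.left_inv]

theorem Homotopic.inv {φ ψ : ContactIsotopy ξ} (h : Homotopic φ ψ) :
    Homotopic φ⁻¹ ψ⁻¹ := by
  obtain ⟨Φ, h0, h1, h2, h3⟩ := h
  exact ⟨Φ⁻¹, fun s hs x => inv_eq_of_toFun_eq Φ (1 : ContactFamily ξ ℝ) (q := 0) (h0 s hs) x,
    fun s hs => inv_eq_of_toFun_eq Φ φ.toContactFamily (h1 s hs),
    fun t ht => inv_eq_of_toFun_eq Φ φ.toContactFamily (h2 t ht),
    fun t ht => inv_eq_of_toFun_eq Φ ψ.toContactFamily (h3 t ht)⟩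

/-- The Hamiltonian `H_t = α(X_t)` of `(φ_t)`, where `X_t (φ_t (z)) = d/dt φ_t (z)`;
at `y` it is evaluated through `z = φ_t⁻¹ (y)`. -/
noncomputable def hamiltonian (α : ∀ x : M, TangentSpace 𝓘(ℝ, E) x →L[ℝ] ℝ)
    (φ : ContactIsotopy ξ) (t : ℝ) (y : M) : ℝ :=
  α (φ.toFun t (φ.invFun t y))
    (mfderiv 𝓘(ℝ, ℝ) 𝓘(ℝ, E) (fun s : ℝ => φ.toFun s (φ.invFun t y)) t (1 : ℝ))

end ContactIsotopy

/-- The universal cover of the identity component `Cont_0(M, ξ)` of the group of compactly supported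
contactomorphisms: contact isotopies starting at the identity, up to homotopy relative to
the endpoints (an equivalence relation, so that `Quot` is the set of its classes). The product
and the inverse are taken pointwise in `t`. -/
def UCont (ξ : ∀ x : M, Submodule ℝ (TangentSpace 𝓘(ℝ, E) x)) : Type _ :=
  Quot (ContactIsotopy.Homotopic (ξ := ξ))

namespace UCont

variable {ξ : ∀ x : M, Submodule ℝ (TangentSpace 𝓘(ℝ, E) x)}

/-- The class `[φ_t]`. -/
def mk (φ : ContactIsotopy ξ) : UCont ξ := Quot.mk _ φ

noncomputable instance : Group (UCont ξ) where
  mul := Quot.map₂ (fun φ ψ => φ * ψ) (fun φ _ _ h => h.mul_left φ) (fun _ _ ψ h => h.mul_right ψ)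
  one := mk 1
  inv := Quot.map (fun φ => φ⁻¹) (fun _ _ h => h.inv)
  mul_assoc := by
    rintro ⟨φ⟩ ⟨ψ⟩ ⟨θ⟩
    exact congrArg mk (mul_assoc φ ψ θ)
  one_mul := by
    rintro ⟨φ⟩
    exact congrArg mk (one_mul φ)
  mul_one := by
    rintro ⟨φ⟩
    exact congrArg mk (mul_one φ)
  inv_mul_cancel := by
    rintro ⟨φ⟩
    exact congrArg mk (inv_mul_cancel φ)

/-- The projection `π` to `Cont_0(M, ξ)`: `[φ_t] ↦ φ_1`. -/
def proj : UCont ξ → (M ≃ₘ⟮𝓘(ℝ, E), 𝓘(ℝ, E)⟯ M) :=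
  Quot.lift
    (fun φ =>
      { toFun := φ.toFun 1
        invFun := φ.invFun 1
        left_inv := φ.left_inv 1
        right_inv := φ.right_inv 1
        contMDiff_toFun := φ.smooth_toFun_apply 1
        contMDiff_invFun := φ.smooth_invFun_apply 1 })
    (fun _ _ h => Diffeomorph.ext h.toFun_one)

end UCont

variable {ξ : ∀ x : M, Submodule ℝ (TangentSpace 𝓘(ℝ, E) x)}

/-- `δ⁻_α(f₀, f₁) = inf {ε ∈ ℝ | ∃ H_t : M → [-ε, ∞), [φ^H_t] f₀ = f₁}`, an extended real. -/
noncomputable def deltaMinus (α : ∀ x : M, TangentSpace 𝓘(ℝ, E) x →L[ℝ] ℝ)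
    (f₀ f₁ : UCont ξ) : EReal :=
  sInf ((fun ε : ℝ => (ε : EReal)) '' {ε : ℝ | ∃ φ : ContactIsotopy ξ,
    (∀ t ∈ Set.Icc (0 : ℝ) 1, ∀ y, -ε ≤ φ.hamiltonian α t y) ∧ UCont.mk φ * f₀ = f₁})

/-- `δ⁺_α(f₀, f₁) = inf {ε ∈ ℝ | ∃ H_t : M → (-∞, ε], [φ^H_t] f₀ = f₁}`, an extended real. -/
noncomputable def deltaPlus (α : ∀ x : M, TangentSpace 𝓘(ℝ, E) x →L[ℝ] ℝ)
    (f₀ f₁ : UCont ξ) : EReal :=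
  sInf ((fun ε : ℝ => (ε : EReal)) '' {ε : ℝ | ∃ φ : ContactIsotopy ξ,
    (∀ t ∈ Set.Icc (0 : ℝ) 1, ∀ y, φ.hamiltonian α t y ≤ ε) ∧ UCont.mk φ * f₀ = f₁})

/-- `d_α = max {δ⁻_α, δ⁺_α, 0}`. -/
noncomputable def dist (α : ∀ x : M, TangentSpace 𝓘(ℝ, E) x →L[ℝ] ℝ) (f₀ f₁ : UCont ξ) : EReal :=
  max (max (deltaMinus α f₀ f₁) (deltaPlus α f₀ f₁)) 0

/-- The metric topology of `d_α`, generated by its open balls. -/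
abbrev metricTopology (ξ : ∀ x : M, Submodule ℝ (TangentSpace 𝓘(ℝ, E) x))
    (α : ∀ x : M, TangentSpace 𝓘(ℝ, E) x →L[ℝ] ℝ) : TopologicalSpace (UCont ξ) :=
  TopologicalSpace.generateFrom
    {B | ∃ (f : UCont ξ) (ε : ℝ), 0 < ε ∧ B = {g | dist α f g < (ε : EReal)}}

/-- `f ≺ g`: there is a positive contact isotopy from `f` to `g`. Positivity of the Hamiltonian
depends on `α` only through the coorientation that it induces. -/
def Prec (α : ∀ x : M, TangentSpace 𝓘(ℝ, E) x →L[ℝ] ℝ) (f g : UCont ξ) : Prop :=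
  ∃ φ : ContactIsotopy ξ,
    (∀ t ∈ Set.Icc (0 : ℝ) 1, ∀ y, 0 < φ.hamiltonian α t y) ∧ UCont.mk φ * f = g

/-- The interval `{f | f₀ ≺ f ≺ f₁}`. -/
def interval (α : ∀ x : M, TangentSpace 𝓘(ℝ, E) x →L[ℝ] ℝ) (f₀ f₁ : UCont ξ) : Set (UCont ξ) :=
  {f | Prec α f₀ f ∧ Prec α f f₁}

/-- The interval topology, generated by all intervals. -/
abbrev intervalTopology (ξ : ∀ x : M, Submodule ℝ (TangentSpace 𝓘(ℝ, E) x))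
    (α : ∀ x : M, TangentSpace 𝓘(ℝ, E) x →L[ℝ] ℝ) : TopologicalSpace (UCont ξ) :=
  TopologicalSpace.generateFrom {B | ∃ f₀ f₁ : UCont ξ, B = interval α f₀ f₁}

/-- `r` is the class `[s ↦ φ^α_{st}, s ∈ [0,1]]` of the time-`t` Reeb flow (for compact `M`). -/
def IsReebLift (α : ∀ x : M, TangentSpace 𝓘(ℝ, E) x →L[ℝ] ℝ) (t : ℝ) (r : UCont ξ) : Prop :=
  ∃ (X : ∀ x : M, TangentSpace 𝓘(ℝ, E) x) (R : ℝ → M → M) (φ : ContactIsotopy ξ),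
    IsReebField α X ∧ (∀ x, R 0 x = x) ∧
    (∀ x, IsMIntegralCurve (I := 𝓘(ℝ, E)) (fun s => R s x) X) ∧
    (∀ s ∈ Set.Icc (0 : ℝ) 1, ∀ x, φ.toFun s x = R (s * t) x) ∧ r = UCont.mk φ

end Isotopies

end ContactMetric

-- Both infima depend only on `u = f₁ f₀⁻¹` or its inverse, through the constants `c` for which the
-- class has a representative with Hamiltonian at least `c` (`HasLowerBound`). Right invariance is
-- then immediate. Running an isotopy backwards, `t ↦ φ_{1-t} φ_1⁻¹`, negates the Hamiltonian, so
-- `δ⁺_α(f₀, f₁) = δ⁻_α(f₁, f₀)` (`deltaPlus_eq`); this gives symmetry and, with right invariance,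
-- the inverse rule. Conjugation by `θ_1` carries Hamiltonians for `α` to Hamiltonians for `θ_1^* α`
-- (`energy_conj`), which gives left naturality. Distances are finite because Hamiltonians have
-- compact support.
--
-- For the triangle inequality, isotopies with Hamiltonians bounded below by negative `a` and `b`
-- are concatenated, sharing time in the ratio `a : b`. The result is bounded below by nearly `a +
-- b`; the arbitrarily small loss pays for a smooth junction (`HasLowerBound.mul`). Negative bounds
-- suffice because the distance is at least `0` by definition.
--
-- On compact `M` the Reeb flow is complete and preserves `α`, so multiplication by its time-`a`
-- lift, on either side, shifts lower bounds by exactly `a` (`shift_mul`, `mul_shift`). This turns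
-- bounds `> -ε` into bounds `> 0`, which by compactness express positivity; hence balls are
-- intervals (`ball_eq_interval`). It also removes the sign condition from concatenation
-- (`hasLowerBound_mul`), so an interval contains a ball around each of its points.
--
-- The Reeb flow itself rests on three facts: the implicit function theorem on a space of curves
-- gives smooth dependence on initial values, an invertible linear system makes the Reeb field
-- smooth, and `L_X α = d(α(X)) + dα(X, ·) = 0` makes `α` invariant.

universe u

namespace ContactMetric

/-! ### Smooth dependence on initial values in a vector space -/

section SmoothFlow

open Set Filter Topology

/-- Evaluation of a continuous family of linear maps on a continuous family of vectors. -/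
noncomputable def applyContinuousMap (K E F : Type*) [TopologicalSpace K] [CompactSpace K]
    [NormedAddCommGroup E] [NormedSpace ℝ E] [NormedAddCommGroup F] [NormedSpace ℝ F] :
    C(K, E →L[ℝ] F) →L[ℝ] C(K, E) →L[ℝ] C(K, F) :=
  LinearMap.mkContinuous₂
    (LinearMap.mk₂ ℝ (fun (A : C(K, E →L[ℝ] F)) (h : C(K, E)) => (⟨fun t => A t (h t), A.continuous.clm_apply h.continuous⟩ : C(K, F)))
      (fun _ _ _ => by ext; simp) (fun _ _ _ => by ext; simp)
      (fun _ _ _ => by ext; simp) (fun _ _ _ => by ext; simp)) 1 (fun A h => by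
        rw [ContinuousMap.norm_le _ (by positivity)]
        intro t
        rw [one_mul]
        exact ((A t).le_opNorm _).trans
          (mul_le_mul (A.norm_coe_le_norm t) (h.norm_coe_le_norm t) (norm_nonneg (h t)) (norm_nonneg A)))

/-- The mean value inequality is applied at each `t` separately; what makes the estimate uniform in
`t` is the sup-norm continuity of `γ ↦ f' ∘ γ`. -/
theorem hasFDerivAt_continuousMap_comp {K E F : Type*} [TopologicalSpace K] [CompactSpace K]
    [NormedAddCommGroup E] [NormedSpace ℝ E] [NormedAddCommGroup F] [NormedSpace ℝ F]
    (f : C(E, F)) (f' : C(E, E →L[ℝ] F)) (hf : ∀ x, HasFDerivAt f (f' x) x) (γ : C(K, E)) :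
    HasFDerivAt (fun γ : C(K, E) => f.comp γ) (applyContinuousMap K E F (f'.comp γ)) γ := by
  rw [hasFDerivAt_iff_isLittleO_nhds_zero, Asymptotics.isLittleO_iff]
  intro c hc
  have hcont : ContinuousAt (fun γ : C(K, E) => f'.comp γ) γ := f'.continuous_postcomp.continuousAt
  obtain ⟨δ, hδ, hδ'⟩ := (Metric.continuousAt_iff (α := C(K, E)) (β := C(K, E →L[ℝ] F))).mp hcont c hc
  filter_upwards [Metric.ball_mem_nhds (0 : C(K, E)) hδ] with h hh
  rw [mem_ball_zero_iff] at hh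
  rw [ContinuousMap.norm_le _ (by positivity)]
  intro t
  have key := (convex_ball (γ t) δ).norm_image_sub_le_of_norm_hasFDerivWithin_le'
    (f := f) (f' := f') (φ := f' (γ t)) (C := c) (x := γ t) (y := γ t + h t)
    (fun z _ => (hf z).hasFDerivWithinAt) (fun z hz => by
      -- The translate of `γ` by the constant `z - γ t` passes through `z` at `t` and stays
      -- `δ`-close to `γ`, so one `δ` controls `f' z - f' (γ t)` for every `t`.
      have h1 : Dist.dist (γ + ContinuousMap.const K (z - γ t)) γ < δ := by
        rw [dist_eq_norm, add_sub_cancel_left, ContinuousMap.norm_lt_iff _ hδ]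
        intro s
        simpa [dist_eq_norm] using hz
      have h2 := (ContinuousMap.dist_apply_le_dist t).trans_lt (hδ' h1)
      have h3 : Dist.dist (f' z) (f' (γ t)) < c := by simpa using h2
      rw [dist_eq_norm] at h3
      exact h3.le) (Metric.mem_ball_self hδ) (by
      rw [Metric.mem_ball, dist_eq_norm, add_sub_cancel_left]
      exact (h.norm_coe_le_norm t).trans_lt hh)
  rw [add_sub_cancel_left] at key
  exact key.trans (mul_le_mul_of_nonneg_left (h.norm_coe_le_norm t) hc.le)

/-- The derivative is composition with `f'` followed by a fixed continuous linear map, so the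
induction passes from `F` to `E →L[ℝ] F`. This is why `F` varies and shares the universe of `E`. -/
theorem contDiff_continuousMap_comp_nat {K : Type*} {E : Type u} [TopologicalSpace K]
    [CompactSpace K] [NormedAddCommGroup E] [NormedSpace ℝ E] (n : ℕ) :
    ∀ {F : Type u} [NormedAddCommGroup F] [NormedSpace ℝ F] (f : C(E, F)), ContDiff ℝ n f →
      ContDiff ℝ n (fun γ : C(K, E) => f.comp γ) := by
  induction n with
  | zero => exact fun f _ => contDiff_zero.mpr f.continuous_postcomp
  | succ n ih =>
    intro F _ _ f hf
    push_cast at hf ⊢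
    have hf' := contDiff_succ_iff_fderiv.mp hf
    set f' : C(E, E →L[ℝ] F) := ⟨fderiv ℝ f, hf'.2.2.continuous⟩
    have hd := hasFDerivAt_continuousMap_comp (K := K) f f' (fun x => (hf'.1 x).hasFDerivAt)
    refine contDiff_succ_iff_fderiv.mpr
      ⟨fun γ => (hd γ).differentiableAt, by simp, ?_⟩
    rw [funext fun γ => (hd γ).fderiv]
    exact (applyContinuousMap K E F).contDiff.comp (ih f' hf'.2.2)

theorem contDiff_continuousMap_comp {K : Type*} {E F : Type u} [TopologicalSpace K]
    [CompactSpace K] [NormedAddCommGroup E] [NormedSpace ℝ E] [NormedAddCommGroup F]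
    [NormedSpace ℝ F] (f : C(E, F)) (hf : ContDiff ℝ ∞ f) :
    ContDiff ℝ ∞ (fun γ : C(K, E) => f.comp γ) :=
  contDiff_infty.mpr fun n => contDiff_continuousMap_comp_nat n f (contDiff_infty.mp hf n)

/-- The primitive vanishing at `0` of a continuous function on `[-2, 2]`. -/
noncomputable def primitiveMap (E : Type*) [NormedAddCommGroup E] [NormedSpace ℝ E] :
    C(Icc (-2 : ℝ) 2, E) →L[ℝ] C(Icc (-2 : ℝ) 2, E) :=
  LinearMap.mkContinuous
    { toFun := fun g => ⟨fun s => ∫ u in (0 : ℝ)..s, g (projIcc (-2) 2 (neg_le_self zero_le_two) u),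
        (intervalIntegral.continuous_primitive
          (fun _ _ => (g.continuous.comp (continuous_projIcc (h := neg_le_self zero_le_two))).intervalIntegrable _ _) 0).comp
          continuous_subtype_val⟩
      map_add' := fun g h => by
        ext s
        exact intervalIntegral.integral_add
          ((g.continuous.comp continuous_projIcc).intervalIntegrable _ _)
          ((h.continuous.comp continuous_projIcc).intervalIntegrable _ _)
      map_smul' := fun c g => by
        ext s
        exact intervalIntegral.integral_smul _ _ } 2 (fun g => by
    rw [ContinuousMap.norm_le _ (by positivity)]
    intro s
    refine (intervalIntegral.norm_integral_le_of_norm_le_const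
      (fun u _ => g.norm_coe_le_norm (projIcc (-2) 2 (neg_le_self zero_le_two) u))).trans ?_
    rw [mul_comm, sub_zero]
    exact mul_le_mul_of_nonneg_right (abs_le.mpr s.2) (norm_nonneg g))

/-- Smooth dependence of the solutions of `γ' = τ v(γ)` on `τ` and on the initial value, for a
vector field that is smooth on the whole space. -/
theorem exists_contDiffAt_flow_of_contDiff {E : Type u} [NormedAddCommGroup E] [NormedSpace ℝ E]
    [CompleteSpace E] {v : E → E} (hv : ContDiff ℝ ∞ v) (y₀ : E) :
    ∃ S : ℝ × E → C(Icc (-2 : ℝ) 2, E), ContDiffAt ℝ ∞ S (0, y₀) ∧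
      S (0, y₀) = ContinuousMap.const _ y₀ ∧
      ∀ᶠ p in 𝓝 ((0 : ℝ), y₀), ∀ s : Icc (-2 : ℝ) 2,
        S p s = p.2 + p.1 • ∫ u in (0 : ℝ)..s, v (S p (projIcc (-2) 2 (neg_le_self zero_le_two) u)) := by
  set K := Icc (-2 : ℝ) 2
  set V : C(E, E) := ⟨v, hv.continuous⟩
  -- The zeros of `G` are the solutions of the integral equation. At `τ = 0` the integral term drops
  -- out, so the partial derivative in the curve is the identity and the implicit function theorem
  -- applies.
  set G : (ℝ × E) × C(K, E) → C(K, E) := fun q =>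
    q.2 - ContinuousLinearMap.const ℝ K q.1.2 - q.1.1 • primitiveMap E (V.comp q.2) with hG
  have hGs : ContDiff ℝ ∞ G := by
    have h1 : ContDiff ℝ ∞ (fun γ : C(K, E) => V.comp γ) := contDiff_continuousMap_comp V hv
    have h2 := (primitiveMap E).contDiff.comp (h1.comp (contDiff_snd (E := ℝ × E)))
    refine (contDiff_snd.sub
      ((ContinuousLinearMap.contDiff _).comp (contDiff_snd.comp contDiff_fst))).sub
      ((contDiff_fst.comp contDiff_fst).smul h2)
  have hder : fderiv ℝ G ((0, y₀), ContinuousMap.const K y₀) ∘L .inr ℝ (ℝ × E) C(K, E) =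
      ContinuousLinearMap.id ℝ _ := by
    have h1 : HasFDerivAt (fun γ : C(K, E) => G ((0, y₀), γ)) (ContinuousLinearMap.id ℝ C(K, E))
        (ContinuousMap.const K y₀) := by
      simp only [hG, zero_smul, sub_zero]
      exact (hasFDerivAt_id _).sub_const _
    have h2 := ((hGs.differentiable (by simp) ((0, y₀), ContinuousMap.const K y₀)).hasFDerivAt).comp
      (ContinuousMap.const K y₀) (hasFDerivAt_prodMk_right ((0 : ℝ), y₀) (ContinuousMap.const K y₀))
    exact h2.unique h1
  have hinv : (fderiv ℝ G ((0, y₀), ContinuousMap.const K y₀) ∘L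
      .inr ℝ (ℝ × E) C(K, E)).IsInvertible := by
    rw [hder]
    exact ⟨ContinuousLinearEquiv.refl ℝ _, rfl⟩
  have hGc := hGs.contDiffAt (x := ((0, y₀), ContinuousMap.const K y₀))
  refine ⟨hGc.implicitFunction (by simp) hinv, hGc.contDiffAt_implicitFunction _ _,
    hGc.implicitFunction_apply_self _ _, ?_⟩
  filter_upwards [hGc.eventually_apply_implicitFunction (by simp) hinv] with p hp s
  have h0 : G ((0, y₀), ContinuousMap.const K y₀) = 0 := by
    ext t
    simp [hG]
  rw [h0] at hp
  generalize hGc.implicitFunction (by simp) hinv p = γ at hp ⊢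
  have := congrArg (fun g : C(K, E) => g s) hp
  simp only [hG, sub_sub, ContinuousMap.sub_apply, ContinuousMap.zero_apply, sub_eq_zero] at this
  rw [this]
  rfl

/-- Smooth dependence of the solutions of `γ' = τ v(γ)` on `τ` and on the initial value. -/
theorem exists_contDiffAt_flow {E : Type u} [NormedAddCommGroup E] [NormedSpace ℝ E]
    [FiniteDimensional ℝ E] {v : E → E} {U : Set E} (hU : IsOpen U) (hv : ContDiffOn ℝ ∞ v U)
    {y₀ : E} (hy₀ : y₀ ∈ U) :
    ∃ Φ : ℝ × E → ℝ → E, ContDiffAt ℝ ∞ (fun p => Φ p 1) (0, y₀) ∧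
      ∀ᶠ p in 𝓝 ((0 : ℝ), y₀), Φ p 0 = p.2 ∧ ∀ s ∈ Ioo (-2 : ℝ) 2,
        Φ p s ∈ U ∧ HasDerivAt (Φ p) (p.1 • v (Φ p s)) s := by
  -- A cutoff extends `v` to the whole space. For parameters near `(0, y₀)` the curve is uniformly
  -- close to the constant `y₀`, hence stays where `χ = 1` and solves the original equation.
  obtain ⟨χ, hχ⟩ : ∃ χ : ContDiffBump y₀, tsupport χ ⊆ U := by
    obtain ⟨r, hr, h⟩ := Metric.nhds_basis_closedBall.mem_iff.mp (hU.mem_nhds hy₀)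
    exact ⟨⟨r / 2, r, half_pos hr, half_lt_self hr⟩, by rwa [ContDiffBump.tsupport_eq]⟩
  set w : E → E := fun y => χ y • v y with hw
  have hws : ContDiff ℝ ∞ w := by
    rw [contDiff_iff_contDiffAt]
    intro y
    by_cases hy : y ∈ U
    · exact χ.contDiff.contDiffAt.smul (hv.contDiffAt (hU.mem_nhds hy))
    · have h0 : w =ᶠ[𝓝 y] fun _ => 0 := by
        filter_upwards [(isClosed_tsupport χ).isOpen_compl.mem_nhds fun h => hy (hχ h)] with z hz
        simp [hw, image_eq_zero_of_notMem_tsupport hz]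
      exact contDiffAt_const.congr_of_eventuallyEq h0
  obtain ⟨S, hS, hS0, hSe⟩ := exists_contDiffAt_flow_of_contDiff hws y₀
  have hle : (-2 : ℝ) ≤ 2 := neg_le_self zero_le_two
  refine ⟨fun p s => S p (projIcc (-2) 2 hle s), ?_, ?_⟩
  · exact ((ContinuousMap.evalCLM ℝ (projIcc (-2) 2 hle (1 : ℝ))).contDiff.contDiffAt).comp _ hS
  · have hnear : ∀ᶠ p in 𝓝 ((0 : ℝ), y₀), S p ∈ Metric.ball (S (0, y₀)) χ.rIn :=
      hS.continuousAt (Metric.ball_mem_nhds _ χ.rIn_pos)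
    filter_upwards [hSe, hnear] with p hp hpn
    have hball : ∀ s, S p s ∈ Metric.closedBall y₀ χ.rIn := fun s => by
      have h1 := (ContinuousMap.dist_apply_le_dist s).trans hpn.le
      rwa [hS0] at h1
    have hone : ∀ s, w (S p s) = v (S p s) := fun s => by
      simp [hw, χ.one_of_mem_closedBall (hball s)]
    have hmem : ∀ s, S p s ∈ U := fun s => by
      refine hχ (subset_tsupport _ ?_)
      rw [Function.mem_support, χ.one_of_mem_closedBall (hball s)]
      exact one_ne_zero
    refine ⟨?_, fun s hs => ⟨hmem _, ?_⟩⟩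
    · rw [hp, projIcc_of_mem hle (by norm_num)]
      simp
    · have hc : Continuous fun u : ℝ => w (S p (projIcc (-2) 2 hle u)) :=
        hws.continuous.comp ((S p).continuous.comp continuous_projIcc)
      have h2 := ((hc.integral_hasStrictDerivAt 0 s).hasDerivAt.const_smul p.1).const_add p.2
      rw [hone] at h2
      refine h2.congr_of_eventuallyEq ?_
      filter_upwards [Ioo_mem_nhds hs.1 hs.2] with u hu
      rw [hp, projIcc_of_mem hle (Ioo_subset_Icc_self hu)]
      rfl

end SmoothFlow

/-! ### Vector fields and tangent maps in charts -/

section Charts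

open Set Filter Topology Bundle

variable {E : Type u} [NormedAddCommGroup E] [NormedSpace ℝ E]
  {M : Type*} [TopologicalSpace M] [ChartedSpace E M]

variable [IsManifold 𝓘(ℝ, E) ∞ M]

theorem contMDiffAt_extChartAt_symm {x₀ : M} {y : E} (hy : y ∈ (extChartAt 𝓘(ℝ, E) x₀).target) :
    ContMDiffAt 𝓘(ℝ, E) 𝓘(ℝ, E) ∞ (extChartAt 𝓘(ℝ, E) x₀).symm y :=
  (contMDiffOn_extChartAt_symm x₀).contMDiffAt ((isOpen_extChartAt_target x₀).mem_nhds hy)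

theorem contMDiffAt_extChartAt_of_mem {x₀ x : M} (hx : x ∈ (extChartAt 𝓘(ℝ, E) x₀).source) :
    ContMDiffAt 𝓘(ℝ, E) 𝓘(ℝ, E) ∞ (extChartAt 𝓘(ℝ, E) x₀) x :=
  contMDiffAt_extChartAt' (by rwa [extChartAt_source] at hx)

theorem mfderiv_extChartAt_mfderiv_symm {x₀ : M} {y : E}
    (hy : y ∈ (extChartAt 𝓘(ℝ, E) x₀).target) (w : E) :
    mfderiv 𝓘(ℝ, E) 𝓘(ℝ, E) (extChartAt 𝓘(ℝ, E) x₀) ((extChartAt 𝓘(ℝ, E) x₀).symm y)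
      (mfderiv 𝓘(ℝ, E) 𝓘(ℝ, E) (extChartAt 𝓘(ℝ, E) x₀).symm y w) = w := by
  have hx := (extChartAt 𝓘(ℝ, E) x₀).map_target hy
  have h := mfderiv_comp_apply (I := 𝓘(ℝ, E)) (I' := 𝓘(ℝ, E)) (I'' := 𝓘(ℝ, E)) y
    ((contMDiffAt_extChartAt_of_mem hx).mdifferentiableAt (by simp))
    ((contMDiffAt_extChartAt_symm hy).mdifferentiableAt (by simp)) w
  rw [← h]
  have he : extChartAt 𝓘(ℝ, E) x₀ ∘ (extChartAt 𝓘(ℝ, E) x₀).symm =ᶠ[𝓝 y] id := by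
    filter_upwards [(isOpen_extChartAt_target x₀).mem_nhds hy] with z hz
    exact (extChartAt 𝓘(ℝ, E) x₀).right_inv hz
  rw [he.mfderiv_eq, mfderiv_id]
  rfl

theorem mfderiv_symm_mfderiv_extChartAt {x₀ x : M} (hx : x ∈ (extChartAt 𝓘(ℝ, E) x₀).source)
    (v : TangentSpace 𝓘(ℝ, E) x) :
    mfderiv 𝓘(ℝ, E) 𝓘(ℝ, E) (extChartAt 𝓘(ℝ, E) x₀).symm (extChartAt 𝓘(ℝ, E) x₀ x)
      (mfderiv 𝓘(ℝ, E) 𝓘(ℝ, E) (extChartAt 𝓘(ℝ, E) x₀) x v) = v := by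
  have h := mfderiv_comp_apply (I := 𝓘(ℝ, E)) (I' := 𝓘(ℝ, E)) (I'' := 𝓘(ℝ, E)) x
    ((contMDiffAt_extChartAt_symm ((extChartAt 𝓘(ℝ, E) x₀).map_source hx)).mdifferentiableAt
      (by simp)) ((contMDiffAt_extChartAt_of_mem hx).mdifferentiableAt (by simp)) v
  rw [← h]
  have he : (extChartAt 𝓘(ℝ, E) x₀).symm ∘ extChartAt 𝓘(ℝ, E) x₀ =ᶠ[𝓝 x] id := by
    filter_upwards [(isOpen_extChartAt_source x₀).mem_nhds hx] with z hz
    exact (extChartAt 𝓘(ℝ, E) x₀).left_inv hz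
  rw [he.mfderiv_eq, mfderiv_id]
  rfl

theorem contMDiffOn_tangentMap_of_isOpen {E' : Type*} [NormedAddCommGroup E'] [NormedSpace ℝ E']
    {M' N : Type*} [TopologicalSpace M'] [ChartedSpace E' M'] [IsManifold 𝓘(ℝ, E') ∞ M']
    [TopologicalSpace N] [ChartedSpace E N] [IsManifold 𝓘(ℝ, E) ∞ N]
    {f : N → M'} {s : Set N} (hs : IsOpen s) (hf : ContMDiffOn 𝓘(ℝ, E) 𝓘(ℝ, E') ∞ f s) :
    ContMDiffOn 𝓘(ℝ, E).tangent 𝓘(ℝ, E').tangent ∞ (tangentMap 𝓘(ℝ, E) 𝓘(ℝ, E') f)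
      (TotalSpace.proj ⁻¹' s) := by
  refine (hf.contMDiffOn_tangentMapWithin (m := ∞) (by simp) hs.uniqueMDiffOn).congr ?_
  rintro ⟨x, v⟩ hx
  rw [tangentMap, tangentMapWithin, mfderivWithin_of_isOpen hs hx]

/-- A smooth vector field on the target of a chart, carried over to the manifold. -/
theorem contMDiffOn_mfderiv_extChartAt_symm {x₀ : M} {V : E → E}
    (hV : ContDiffOn ℝ ∞ V (extChartAt 𝓘(ℝ, E) x₀).target) :
    ContMDiffOn 𝓘(ℝ, E) 𝓘(ℝ, E).tangent ∞
      (fun y => (⟨(extChartAt 𝓘(ℝ, E) x₀).symm y,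
        mfderiv 𝓘(ℝ, E) 𝓘(ℝ, E) (extChartAt 𝓘(ℝ, E) x₀).symm y (V y)⟩ :
          TangentBundle 𝓘(ℝ, E) M)) (extChartAt 𝓘(ℝ, E) x₀).target :=
  (contMDiffOn_tangentMap_of_isOpen (isOpen_extChartAt_target x₀)
    (contMDiffOn_extChartAt_symm x₀)).comp
    ((contMDiffOn_vectorSpace_iff_contDiffOn (V := V)).mpr hV) (fun _ hy => hy)

/-- A smooth vector field on the manifold, read in a chart. -/
theorem contDiffOn_mfderiv_extChartAt {X : ∀ x : M, TangentSpace 𝓘(ℝ, E) x}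
    (hX : ContMDiff 𝓘(ℝ, E) 𝓘(ℝ, E).tangent ∞ (fun x => (⟨x, X x⟩ : TangentBundle 𝓘(ℝ, E) M)))
    (x₀ : M) :
    ContDiffOn ℝ ∞ (fun y : E => (mfderiv 𝓘(ℝ, E) 𝓘(ℝ, E) (extChartAt 𝓘(ℝ, E) x₀)
      ((extChartAt 𝓘(ℝ, E) x₀).symm y) (X ((extChartAt 𝓘(ℝ, E) x₀).symm y)) : E))
      (extChartAt 𝓘(ℝ, E) x₀).target := by
  have h1 := (contMDiff_snd_tangentBundle_modelSpace E 𝓘(ℝ, E) (n := ∞)).comp_contMDiffOn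
    ((contMDiffOn_tangentMap_of_isOpen (isOpen_extChartAt_source (I := 𝓘(ℝ, E)) x₀)
      (f := extChartAt 𝓘(ℝ, E) x₀) (by
        intro x hx
        exact (contMDiffAt_extChartAt_of_mem hx).contMDiffWithinAt)).comp
    (hX.comp_contMDiffOn (contMDiffOn_extChartAt_symm (I := 𝓘(ℝ, E)) (n := ∞) x₀))
    (fun y hy => (extChartAt 𝓘(ℝ, E) x₀).map_target hy))
  exact h1.contDiffOn

end Charts

/-! ### Local and global flows of smooth vector fields -/

section Flow

open Set Filter Topology

variable {E : Type u} [NormedAddCommGroup E] [NormedSpace ℝ E] [FiniteDimensional ℝ E]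
  {M : Type*} [TopologicalSpace M] [ChartedSpace E M] [IsManifold 𝓘(ℝ, E) ∞ M]

/-- Smooth dependence of the integral curves of `τ X` on `τ` and on the initial value, locally. -/
theorem exists_local_flow {X : ∀ x : M, TangentSpace 𝓘(ℝ, E) x}
    (hX : ContMDiff 𝓘(ℝ, E) 𝓘(ℝ, E).tangent ∞ (fun x => (⟨x, X x⟩ : TangentBundle 𝓘(ℝ, E) M)))
    (x₀ : M) :
    ∃ Θ : ℝ × M → ℝ → M,
      ContMDiffAt (𝓘(ℝ, ℝ).prod 𝓘(ℝ, E)) 𝓘(ℝ, E) ∞ (fun q => Θ q 1) (0, x₀) ∧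
      ∀ᶠ q in 𝓝 ((0 : ℝ), x₀), Θ q 0 = q.2 ∧
        IsMIntegralCurveOn (I := 𝓘(ℝ, E)) (Θ q) (q.1 • X) (Ioo (-2) 2) := by
  set φ := extChartAt 𝓘(ℝ, E) x₀ with hφ
  have hx₀ : x₀ ∈ φ.source := mem_extChartAt_source x₀
  obtain ⟨Φ, hΦ, hev⟩ := exists_contDiffAt_flow (isOpen_extChartAt_target x₀)
    (contDiffOn_mfderiv_extChartAt hX x₀) (φ.map_source hx₀)
  have hφ₀ : ContMDiffAt (𝓘(ℝ, ℝ).prod 𝓘(ℝ, E)) (𝓘(ℝ, ℝ × E)) ∞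
      (fun q : ℝ × M => (q.1, φ q.2)) (0, x₀) :=
    contMDiffAt_fst.prodMk_space
      ((contMDiffAt_extChartAt_of_mem hx₀).comp (0, x₀) contMDiffAt_snd)
  have hΦ₀ : Φ (0, φ x₀) 1 ∈ φ.target := by
    have := hev.self_of_nhds
    exact (this.2 1 (by norm_num)).1
  refine ⟨fun q s => φ.symm (Φ (q.1, φ q.2) s), ?_, ?_⟩
  · exact (contMDiffAt_extChartAt_symm hΦ₀).comp (0, x₀)
      ((hΦ.contMDiffAt (x := ((0 : ℝ), φ x₀))).comp (0, x₀) hφ₀)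
  · have hsrc : ∀ᶠ q in 𝓝 ((0 : ℝ), x₀), q.2 ∈ φ.source :=
      continuous_snd.continuousAt.eventually ((isOpen_extChartAt_source x₀).mem_nhds hx₀)
    filter_upwards [hφ₀.continuousAt.eventually hev, hsrc] with q hq hqs
    refine ⟨by rw [hq.1, φ.left_inv hqs], fun s hs => ?_⟩
    obtain ⟨hmem, hder⟩ := hq.2 s hs
    have h1 := ((contMDiffAt_extChartAt_symm hmem).mdifferentiableAt (by simp)).hasMFDerivAt
    have h2 := h1.comp s hder.hasFDerivAt.hasMFDerivAt
    refine HasMFDerivAt.hasMFDerivWithinAt ?_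
    have h3 := mfderiv_symm_mfderiv_extChartAt (φ.map_target hmem) (X (φ.symm (Φ (q.1, φ q.2) s)))
    rw [φ.right_inv hmem] at h3
    refine HasMFDerivAt.congr_mfderiv h2 (ContinuousLinearMap.ext fun (r : ℝ) => ?_)
    have hA : ∀ (A : E →L[ℝ] E) (w z : E), A w = z → A (r • q.1 • w) = r • q.1 • z :=
      fun A w z h => by rw [map_smul, map_smul, h]
    exact hA (mfderiv 𝓘(ℝ, E) 𝓘(ℝ, E) φ.symm (Φ (q.1, φ q.2) s)) _ _ h3

variable [T2Space M] [CompactSpace M]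

/-- A smooth vector field on a compact manifold has a smooth global flow. -/
theorem exists_global_flow {X : ∀ x : M, TangentSpace 𝓘(ℝ, E) x}
    (hX : ContMDiff 𝓘(ℝ, E) 𝓘(ℝ, E).tangent ∞ (fun x => (⟨x, X x⟩ : TangentBundle 𝓘(ℝ, E) M))) :
    ∃ R : ℝ → M → M, (∀ x, R 0 x = x) ∧ (∀ s t x, R (s + t) x = R s (R t x)) ∧
      (∀ x, IsMIntegralCurve (I := 𝓘(ℝ, E)) (fun s => R s x) X) ∧
      ContMDiff (𝓘(ℝ, ℝ).prod 𝓘(ℝ, E)) 𝓘(ℝ, E) ∞ (fun q : ℝ × M => R q.1 q.2) := by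
  have : IsManifold 𝓘(ℝ, E) 1 M := IsManifold.of_le (n := ∞) (by simp)
  have hX1 : ContMDiff 𝓘(ℝ, E) 𝓘(ℝ, E).tangent 1
    (fun x => (⟨x, X x⟩ : TangentBundle 𝓘(ℝ, E) M)) := hX.of_le (by simp)
  choose Θ hΘ hΘe using exists_local_flow hX
  -- Compactness gives one `δ` such that `τ X` has integral curves on `(-2, 2)` from every point
  -- when `|τ| < δ`. Rescaling time by `δ / 2` yields a uniform existence time for `X`, hence
  -- completeness.
  have hε : ∃ ε > 0, ∀ x : M, ∃ γ : ℝ → M, γ 0 = x ∧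
      IsMIntegralCurveOn (I := 𝓘(ℝ, E)) γ X (Ioo (-ε) ε) := by
    have h1 : ∀ᶠ τ in 𝓝 (0 : ℝ), ∀ x ∈ (univ : Set M), ∃ Θ : ℝ → M, Θ 0 = x ∧
        IsMIntegralCurveOn (I := 𝓘(ℝ, E)) Θ (τ • X) (Ioo (-2) 2) := by
      refine isCompact_univ.eventually_forall_of_forall_eventually fun x _ => ?_
      filter_upwards [hΘe x] with q hq
      exact ⟨_, hq⟩
    obtain ⟨δ, hδ, h2⟩ := Metric.eventually_nhds_iff.mp h1
    refine ⟨δ / 2, half_pos hδ, fun x => ?_⟩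
    obtain ⟨γ, hγ0, hγ⟩ := h2 (y := δ / 2) (by simp [abs_of_pos hδ]; linarith) x (mem_univ x)
    refine ⟨γ ∘ (· * (δ / 2)⁻¹), by simp [hγ0], ?_⟩
    have h3 := hγ.comp_mul (δ / 2)⁻¹
    rw [smul_smul, inv_mul_cancel₀ (half_pos hδ).ne', one_smul] at h3
    refine h3.mono fun t ht => ?_
    have hd : (0 : ℝ) < δ / 2 := half_pos hδ
    rw [mem_ofPred_eq, ← div_eq_mul_inv, mem_Ioo, lt_div_iff₀ hd, div_lt_iff₀ hd]
    constructor <;> linarith [ht.1, ht.2]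
  obtain ⟨ε, hε0, hε⟩ := hε
  choose γ hγ0 hγ using exists_isMIntegralCurve_of_isMIntegralCurveOn hX1 hε0 hε
  have hadd : ∀ s t x, γ x (s + t) = γ (γ x t) s := fun s t x => by
    have := isMIntegralCurve_Ioo_eq_of_contMDiff_boundaryless (t₀ := 0) hX1
      ((hγ x).comp_add t) (hγ (γ x t)) (by simp [hγ0])
    exact congrFun this s
  refine ⟨fun t x => γ x t, hγ0, hadd, hγ, ?_⟩
  -- Both `s ↦ γ x (s τ)` and the local solution integrate `τ X` from `x`; uniqueness, evaluated at
  -- `s = 1`, identifies them.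
  have hloc : ∀ x₀, ContMDiffAt (𝓘(ℝ, ℝ).prod 𝓘(ℝ, E)) 𝓘(ℝ, E) ∞
      (fun q : ℝ × M => γ q.2 q.1) (0, x₀) := fun x₀ => by
    refine (hΘ x₀).congr_of_eventuallyEq ?_
    filter_upwards [hΘe x₀] with q hq
    have hs : ContMDiff 𝓘(ℝ, E) 𝓘(ℝ, E).tangent 1
      (fun x => (⟨x, (q.1 • X) x⟩ : TangentBundle 𝓘(ℝ, E) M)) := hX1.const_smul_section
    have h1 := isMIntegralCurveOn_Ioo_eqOn_of_contMDiff_boundaryless (t₀ := 0)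
      (a := -2) (b := 2) (by norm_num) hs (((hγ q.2).comp_mul q.1).isMIntegralCurveOn _) hq.2
      (by simp [hγ0, hq.1])
    have h2 := h1 (show (1 : ℝ) ∈ Ioo (-2 : ℝ) 2 by norm_num)
    simpa using h2
  rw [contMDiff_infty]
  intro n
  -- Being `C^n` at a point is an open condition for finite `n` only, hence the reduction to finite
  -- `n` before compactness is used.
  have hunif : ∀ᶠ τ in 𝓝 (0 : ℝ), ∀ x ∈ (univ : Set M),
      ContMDiffAt (𝓘(ℝ, ℝ).prod 𝓘(ℝ, E)) 𝓘(ℝ, E) n (fun q : ℝ × M => γ q.2 q.1) (τ, x) := by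
    refine isCompact_univ.eventually_forall_of_forall_eventually fun x _ => ?_
    exact (contMDiffAt_iff_contMDiffAt_nhds (by simp)).mp
      ((hloc x).of_le (WithTop.coe_le_coe.mpr le_top))
  obtain ⟨δ, hδ, hunif⟩ := Metric.eventually_nhds_iff.mp hunif
  have hsmall : ∀ τ : ℝ, |τ| < δ → ContMDiff 𝓘(ℝ, E) 𝓘(ℝ, E) n (fun x => γ x τ) := fun τ hτ x =>
    (hunif (y := τ) (by simpa using hτ) x (mem_univ x)).comp x
      (contMDiffAt_const.prodMk contMDiffAt_id)
  -- The time-`t` map is an iterate of the map at a time `t / N` of absolute value below `δ`.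
  have hall : ∀ t : ℝ, ContMDiff 𝓘(ℝ, E) 𝓘(ℝ, E) n (fun x => γ x t) := fun t => by
    obtain ⟨N, hN⟩ := exists_nat_gt (|t| / δ)
    have hN0 : (0 : ℝ) < N := (by positivity : 0 ≤ |t| / δ).trans_lt hN
    have hk : ∀ k : ℕ, ContMDiff 𝓘(ℝ, E) 𝓘(ℝ, E) n (fun x => γ x (k * (t / N))) := fun k => by
      induction k with
      | zero =>
        simp only [Nat.cast_zero, zero_mul, hγ0]
        exact contMDiff_id
      | succ k ih =>
        have h1 : |t / N| < δ := by
          rw [abs_div, abs_of_pos hN0, div_lt_iff₀ hN0]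
          rwa [div_lt_iff₀ hδ, mul_comm] at hN
        have h2 := (hsmall _ h1).comp ih
        refine h2.congr fun x => ?_
        simp only [Function.comp]
        rw [← hadd]
        push_cast
        ring_nf
    have := hk N
    rwa [mul_div_cancel₀ _ hN0.ne'] at this
  rintro ⟨t, x⟩
  -- By the group law the flow near time `t` is the flow near time `0` applied after the time-`t`
  -- map.
  have h1 : (fun q : ℝ × M => γ q.2 q.1) =
      (fun q : ℝ × M => γ q.2 q.1) ∘ (fun q : ℝ × M => (q.1 - t, γ q.2 t)) := by
    ext q
    simp only [Function.comp]
    rw [← hadd, sub_add_cancel]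
  rw [h1]
  refine ContMDiffAt.comp (I' := 𝓘(ℝ, ℝ).prod 𝓘(ℝ, E)) (t, x)
    (by simpa using (hloc (γ x t)).of_le (by exact_mod_cast le_top)) ?_
  exact (contMDiffAt_fst.sub contMDiffAt_const).prodMk ((hall t _).comp (t, x) contMDiffAt_snd)

end Flow

/-! ### Existence and smoothness of the Reeb field -/

section Reeb

open Set Filter Topology

/-- A nonzero functional `a` and a bilinear form `b`, alternating and nondegenerate on `ker a`, have
a Reeb vector. -/
theorem exists_reeb_vector {E : Type*} [AddCommGroup E] [Module ℝ E] [FiniteDimensional ℝ E]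
    (a : E →ₗ[ℝ] ℝ) (b : E →ₗ[ℝ] E →ₗ[ℝ] ℝ) (ha : a ≠ 0) (hb : ∀ v, b v v = 0)
    (hn : ∀ v, a v = 0 → (∀ w, a w = 0 → b v w = 0) → v = 0) :
    ∃ r, a r = 1 ∧ ∀ w, b r w = 0 := by
  obtain ⟨u₀, hu₀⟩ : ∃ u₀, a u₀ ≠ 0 := by
    by_contra! h
    exact ha (LinearMap.ext h)
  obtain ⟨u, hu⟩ : ∃ u, a u = 1 := ⟨(a u₀)⁻¹ • u₀, by simp [hu₀]⟩
  -- Nondegeneracy makes `T` injective, hence surjective onto the dual. Some `k` in the kernel thus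
  -- satisfies `b k = b u` on `ker a`, and `u - k` is the Reeb vector.
  set T : LinearMap.ker a →ₗ[ℝ] Module.Dual ℝ (LinearMap.ker a) :=
    b.compl₁₂ (LinearMap.ker a).subtype (LinearMap.ker a).subtype with hT
  have hTinj : Function.Injective T := by
    rw [← LinearMap.ker_eq_bot, LinearMap.ker_eq_bot']
    rintro ⟨v, hv⟩ h
    refine Subtype.ext (hn v hv fun w hw => ?_)
    exact LinearMap.congr_fun h ⟨w, hw⟩
  obtain ⟨⟨k, hk⟩, hTk⟩ := (LinearMap.injective_iff_surjective_of_finrank_eq_finrank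
    (Subspace.dual_finrank_eq (K := ℝ) (V := LinearMap.ker a)).symm).mp hTinj
    ((b u).comp (LinearMap.ker a).subtype)
  have hk' : a k = 0 := hk
  have har : a (u - k) = 1 := by rw [map_sub, hu, hk', sub_zero]
  have hker : ∀ w, a w = 0 → b (u - k) w = 0 := fun w hw => by
    have := LinearMap.congr_fun hTk ⟨w, hw⟩
    simp only [hT, LinearMap.compl₁₂_apply, Submodule.subtype_apply, LinearMap.comp_apply] at this
    rw [map_sub, LinearMap.sub_apply, this, sub_self]
  refine ⟨u - k, har, fun w => ?_⟩
  have h1 := hker (w - a w • (u - k)) (by rw [map_sub, map_smul, har]; simp)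
  rwa [map_sub, map_smul, hb, smul_zero, sub_zero] at h1

/-- The exterior derivative commutes with pullbacks. -/
theorem skew_fderiv_pullback {E : Type*} [NormedAddCommGroup E] [NormedSpace ℝ E]
    {a : E → E →L[ℝ] ℝ} {g : E → E} {y : E} (ha : DifferentiableAt ℝ a (g y))
    (hg : ContDiffAt ℝ 2 g y) (v w : E) :
    fderiv ℝ (fun z => (a (g z)).comp (fderiv ℝ g z)) y v w -
      fderiv ℝ (fun z => (a (g z)).comp (fderiv ℝ g z)) y w v =
    fderiv ℝ a (g y) (fderiv ℝ g y v) (fderiv ℝ g y w) -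
      fderiv ℝ a (g y) (fderiv ℝ g y w) (fderiv ℝ g y v) := by
  have h1 : HasFDerivAt (fun z => a (g z)) _ y :=
    ha.hasFDerivAt.comp y (hg.differentiableAt (by simp)).hasFDerivAt
  have h2 : HasFDerivAt (fderiv ℝ g) _ y :=
    ((hg.fderiv_right (m := 1) (by norm_num)).differentiableAt (by simp)).hasFDerivAt
  -- The terms containing second derivatives of `g` are symmetric in `v` and `w`, so they cancel in
  -- the difference.
  have hsymm := (hg.isSymmSndFDerivAt (by simp)).eq v w
  rw [(h1.clm_comp h2).fderiv]
  simp only [add_apply, ContinuousLinearMap.comp_apply,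
    ContinuousLinearMap.compL_apply, ContinuousLinearMap.flip_apply]
  rw [hsymm]
  ring

/-- The Reeb field of a smooth 1-form on an open subset of a vector space is smooth. -/
theorem contDiffOn_reeb_vector {E : Type*} [NormedAddCommGroup E] [NormedSpace ℝ E]
    [FiniteDimensional ℝ E] {U : Set E} (hU : IsOpen U) {a : E → E →L[ℝ] ℝ}
    (ha : ContDiffOn ℝ ∞ a U) {V : E → E} (haV : ∀ y ∈ U, a y (V y) = 1)
    (hdV : ∀ y ∈ U, ∀ w, fderiv ℝ a y (V y) w - fderiv ℝ a y w (V y) = 0)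
    (hn : ∀ y ∈ U, ∀ v, a y v = 0 →
      (∀ w, fderiv ℝ a y v w - fderiv ℝ a y w v = 0) → v = 0) :
    ContDiffOn ℝ ∞ V U := by
  set B : E → E →L[ℝ] E →L[ℝ] ℝ := fun y => fderiv ℝ a y - (fderiv ℝ a y).flip with hB
  -- Adding `a ⊗ a` to `da` makes the form nondegenerate on the whole space, and the Reeb equations
  -- become the single equation `L V = a`. So `V = L⁻¹ a`, which is smooth because inversion of
  -- linear maps is.
  set L : E → E →L[ℝ] E →L[ℝ] ℝ := fun y => B y + (a y).smulRight (a y) with hL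
  have hBa : ∀ y v w, B y v w = fderiv ℝ a y v w - fderiv ℝ a y w v := fun _ _ _ => rfl
  have hLa : ∀ y v w, L y v w = B y v w + a y v * a y w := fun _ _ _ => rfl
  have hLV : ∀ y ∈ U, L y (V y) = a y := fun y hy => by
    ext w
    rw [hLa, hBa, hdV y hy, haV y hy, zero_add, one_mul]
  have hLinj : ∀ y ∈ U, Function.Injective (L y) := fun y hy => by
    rw [injective_iff_map_eq_zero]
    intro v hv
    have hLv : ∀ w, B y v w + a y v * a y w = 0 := fun w => by
      rw [← hLa, hv]
      rfl
    have hav : a y v = 0 := by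
      have h := hLv (V y)
      rw [haV y hy, mul_one, hBa] at h
      linarith [hdV y hy v]
    refine hn y hy v hav fun w => ?_
    have h := hLv w
    rwa [hav, zero_mul, add_zero] at h
  intro y hy
  have hfin : Module.finrank ℝ E = Module.finrank ℝ (E →L[ℝ] ℝ) := by
    rw [← (LinearMap.toContinuousLinearMap (𝕜 := ℝ) (E := E) (F' := ℝ)).finrank_eq]
    exact (Subspace.dual_finrank_eq (K := ℝ) (V := E)).symm
  have hinv : ∀ z ∈ U, ∃ e : E ≃L[ℝ] (E →L[ℝ] ℝ), (e : E →L[ℝ] E →L[ℝ] ℝ) = L z :=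
    fun z hz => ⟨(LinearEquiv.ofInjectiveOfFinrankEq (L z).toLinearMap (hLinj z hz)
      hfin).toContinuousLinearEquiv, by ext; rfl⟩
  have hVL : ∀ z ∈ U, V z = (L z).inverse (a z) := fun z hz => by
    obtain ⟨e, he⟩ := hinv z hz
    rw [← hLV z hz, ← he, ContinuousLinearMap.inverse_equiv]
    simp
  obtain ⟨e, he⟩ := hinv y hy
  have hay : ContDiffAt ℝ ∞ a y := ha.contDiffAt (hU.mem_nhds hy)
  have hda : ContDiffAt ℝ ∞ (fderiv ℝ a) y := hay.fderiv_right (by simp)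
  have hflip : ContDiffAt ℝ ∞ (fun z => (fderiv ℝ a z).flip) y := by
    have h1 : ContDiffOn ℝ ∞ (fun z => (fderiv ℝ a z).flip) U := by
      rw [contDiffOn_clm_apply]
      intro v
      rw [contDiffOn_clm_apply]
      intro w
      exact ((ha.fderiv_of_isOpen hU (by simp)).clm_apply contDiffOn_const).clm_apply
        contDiffOn_const
    exact h1.contDiffAt (hU.mem_nhds hy)
  have hLs : ContDiffAt ℝ ∞ L y := (hda.sub hflip).add (hay.smulRight hay)
  have hinvs : ContDiffAt ℝ ∞ (fun z => (L z).inverse) y := by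
    have h1 := contDiffAt_map_inverse (n := ∞) e
    rw [he] at h1
    exact h1.comp y hLs
  refine ((hinvs.clm_apply hay).congr_of_eventuallyEq ?_).contDiffWithinAt
  filter_upwards [hU.mem_nhds hy] with z hz
  exact hVL z hz

variable {E : Type u} [NormedAddCommGroup E] [NormedSpace ℝ E]
  {M : Type*} [TopologicalSpace M] [ChartedSpace E M] [IsManifold 𝓘(ℝ, E) ∞ M]
  {ξ : ∀ x : M, Submodule ℝ (TangentSpace 𝓘(ℝ, E) x)}
  {α : ∀ x : M, TangentSpace 𝓘(ℝ, E) x →L[ℝ] ℝ}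

theorem contDiffOn_formInChart [FiniteDimensional ℝ E]
    (hα : ContMDiff (𝓘(ℝ, E).tangent) 𝓘(ℝ, ℝ) ∞
      (fun v : TangentBundle 𝓘(ℝ, E) M => α v.proj v.snd)) (x₀ : M) :
    ContDiffOn ℝ ∞ (formInChart α x₀) (extChartAt 𝓘(ℝ, E) x₀).target := by
  rw [contDiffOn_clm_apply]
  intro w
  exact (hα.comp_contMDiffOn
    (contMDiffOn_mfderiv_extChartAt_symm (V := fun _ => w) contDiffOn_const)).contDiffOn

theorem formInChart_apply_mfderiv {x₀ x : M} (hx : x ∈ (extChartAt 𝓘(ℝ, E) x₀).source)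
    (v : TangentSpace 𝓘(ℝ, E) x) :
    formInChart α x₀ (extChartAt 𝓘(ℝ, E) x₀ x)
      (mfderiv 𝓘(ℝ, E) 𝓘(ℝ, E) (extChartAt 𝓘(ℝ, E) x₀) x v) = α x v := by
  have h := mfderiv_symm_mfderiv_extChartAt hx v
  -- All tangent spaces are definitionally `E`; with the vector taken in `E`, the base point `φ.symm
  -- (φ x)` can be replaced by `x` by substitution.
  have hA : ∀ (p : M) (w : E), p = x → w = v → α p w = α x v := by
    rintro p w rfl rfl
    rfl
  exact hA _ _ ((extChartAt 𝓘(ℝ, E) x₀).left_inv hx) h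

/-- The exterior derivative may be computed in any chart. -/
theorem extDerivForm_eq [FiniteDimensional ℝ E]
    (hα : ContMDiff (𝓘(ℝ, E).tangent) 𝓘(ℝ, ℝ) ∞
      (fun v : TangentBundle 𝓘(ℝ, E) M => α v.proj v.snd)) {x₀ x : M}
    (hx : x ∈ (extChartAt 𝓘(ℝ, E) x₀).source) (v w : TangentSpace 𝓘(ℝ, E) x) :
    extDerivForm α x v w =
      fderiv ℝ (formInChart α x₀) (extChartAt 𝓘(ℝ, E) x₀ x)
        (mfderiv 𝓘(ℝ, E) 𝓘(ℝ, E) (extChartAt 𝓘(ℝ, E) x₀) x v)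
        (mfderiv 𝓘(ℝ, E) 𝓘(ℝ, E) (extChartAt 𝓘(ℝ, E) x₀) x w) -
      fderiv ℝ (formInChart α x₀) (extChartAt 𝓘(ℝ, E) x₀ x)
        (mfderiv 𝓘(ℝ, E) 𝓘(ℝ, E) (extChartAt 𝓘(ℝ, E) x₀) x w)
        (mfderiv 𝓘(ℝ, E) 𝓘(ℝ, E) (extChartAt 𝓘(ℝ, E) x₀) x v) := by
  set φ := extChartAt 𝓘(ℝ, E) x₀
  set ψ := extChartAt 𝓘(ℝ, E) x
  have hxψ : x ∈ ψ.source := mem_extChartAt_source x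
  have hyt : ψ x ∈ ψ.target := ψ.map_source hxψ
  have hyx : ψ.symm (ψ x) = x := ψ.left_inv hxψ
  set g : E → E := φ ∘ ψ.symm with hg
  have hgy : g (ψ x) = φ x := congrArg φ hyx
  have hev : ∀ᶠ z in 𝓝 (ψ x), z ∈ ψ.target ∧ ψ.symm z ∈ φ.source := by
    refine Filter.Eventually.and ((isOpen_extChartAt_target x).mem_nhds hyt) ?_
    exact (contMDiffAt_extChartAt_symm hyt).continuousAt.eventually
      ((isOpen_extChartAt_source x₀).mem_nhds (by rwa [hyx]))
  have hgd : ∀ z, z ∈ ψ.target → ψ.symm z ∈ φ.source → ∀ u : E, fderiv ℝ g z u =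
      mfderiv 𝓘(ℝ, E) 𝓘(ℝ, E) φ (ψ.symm z) (mfderiv 𝓘(ℝ, E) 𝓘(ℝ, E) ψ.symm z u) := by
    intro z hz hz' u
    rw [← mfderiv_eq_fderiv]
    exact mfderiv_comp_apply (I := 𝓘(ℝ, E)) (I' := 𝓘(ℝ, E)) (I'' := 𝓘(ℝ, E)) z
      ((contMDiffAt_extChartAt_of_mem hz').mdifferentiableAt (by simp))
      ((contMDiffAt_extChartAt_symm hz).mdifferentiableAt (by simp)) u
  -- The two coordinate expressions of `α` differ by pullback under the transition map `g`, which
  -- reduces the claim to `skew_fderiv_pullback`.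
  have hform : formInChart α x =ᶠ[𝓝 (ψ x)]
      fun z => (formInChart α x₀ (g z)).comp (fderiv ℝ g z) := by
    filter_upwards [hev] with z hz
    ext u
    rw [ContinuousLinearMap.comp_apply, hgd z hz.1 hz.2]
    exact (formInChart_apply_mfderiv hz.2 _).symm
  have hgs : ContDiffAt ℝ 2 g (ψ x) := by
    have h1 : ContMDiffAt 𝓘(ℝ, E) 𝓘(ℝ, E) ∞ g (ψ x) :=
      (contMDiffAt_extChartAt_of_mem (x₀ := x₀) (by rwa [hyx])).comp (ψ x)
        (contMDiffAt_extChartAt_symm hyt)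
    exact h1.contDiffAt.of_le (WithTop.coe_le_coe.mpr le_top)
  have ha : DifferentiableAt ℝ (formInChart α x₀) (g (ψ x)) := by
    rw [hgy]
    exact ((contDiffOn_formInChart hα x₀).contDiffAt
      ((isOpen_extChartAt_target x₀).mem_nhds (φ.map_source hx))).differentiableAt (by simp)
  have hvec : ∀ u : TangentSpace 𝓘(ℝ, E) x,
      fderiv ℝ g (ψ x) (mfderiv 𝓘(ℝ, E) 𝓘(ℝ, E) ψ x u) = mfderiv 𝓘(ℝ, E) 𝓘(ℝ, E) φ x u := by
    intro u
    refine (hgd _ hyt (by rwa [hyx]) _).trans ?_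
    have hA : ∀ (p : M) (w : E), p = x → w = u →
        (mfderiv 𝓘(ℝ, E) 𝓘(ℝ, E) φ p w : E) = mfderiv 𝓘(ℝ, E) 𝓘(ℝ, E) φ x u := by
      rintro p w rfl rfl
      rfl
    exact hA _ _ hyx (mfderiv_symm_mfderiv_extChartAt hxψ u)
  have key := skew_fderiv_pullback ha hgs (mfderiv 𝓘(ℝ, E) 𝓘(ℝ, E) ψ x v)
    (mfderiv 𝓘(ℝ, E) 𝓘(ℝ, E) ψ x w)
  rw [hvec v, hvec w, hgy, ← hform.fderiv_eq] at key
  exact key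

variable [FiniteDimensional ℝ E]

theorem exists_isReebField (hα : IsContactForm ξ α) :
    ∃ X : ∀ x : M, TangentSpace 𝓘(ℝ, E) x, IsReebField α X := by
  have h : ∀ x : M, ∃ r : TangentSpace 𝓘(ℝ, E) x, α x r = 1 ∧ ∀ v, extDerivForm α x r v = 0 := by
    intro x
    set D : E →L[ℝ] E := mfderiv 𝓘(ℝ, E) 𝓘(ℝ, E) (extChartAt 𝓘(ℝ, E) x) x
    set F : E →L[ℝ] E →L[ℝ] ℝ := fderiv ℝ (formInChart α x) (extChartAt 𝓘(ℝ, E) x x)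
    set b : E →ₗ[ℝ] E →ₗ[ℝ] ℝ := LinearMap.mk₂ ℝ (fun v w => F (D v) (D w) - F (D w) (D v))
      (fun _ _ _ => by simp; ring) (fun _ _ _ => by simp; ring)
      (fun _ _ _ => by simp; ring) (fun _ _ _ => by simp; ring)
    have hb : ∀ v w : E, b v w = extDerivForm α x v w := fun _ _ => rfl
    have ha : ∀ v : E, α x v = (show E →L[ℝ] ℝ from α x).toLinearMap v := fun _ => rfl
    exact exists_reeb_vector (E := E) (show E →L[ℝ] ℝ from α x).toLinearMap b
      (fun h0 => hα.ne_zero x (ContinuousLinearMap.ext fun v => LinearMap.congr_fun h0 v))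
      (fun v => sub_self _)
      (fun v hv hw => hα.nondegenerate x v ((hα.mem_iff x v).mpr hv)
        fun w hw' => hw w ((hα.mem_iff x w).mp hw'))
  choose X hX using h
  exact ⟨X, hX⟩

/-- The Reeb vectors are chosen pointwise; smoothness comes from the linear equation that determines
them. Since `extDerivForm` uses a different chart at each point, it is first moved to the fixed
chart at `x₀`. -/
theorem contDiffOn_reebField (hα : IsContactForm ξ α) {X : ∀ x : M, TangentSpace 𝓘(ℝ, E) x}
    (hX : IsReebField α X) (x₀ : M) :
    ContDiffOn ℝ ∞ (fun y : E => (mfderiv 𝓘(ℝ, E) 𝓘(ℝ, E) (extChartAt 𝓘(ℝ, E) x₀)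
      ((extChartAt 𝓘(ℝ, E) x₀).symm y) (X ((extChartAt 𝓘(ℝ, E) x₀).symm y)) : E))
      (extChartAt 𝓘(ℝ, E) x₀).target := by
  set φ := extChartAt 𝓘(ℝ, E) x₀ with hφ
  have hBd : ∀ y ∈ φ.target, ∀ v w : TangentSpace 𝓘(ℝ, E) (φ.symm y),
      extDerivForm α (φ.symm y) v w =
        fderiv ℝ (formInChart α x₀) y (mfderiv 𝓘(ℝ, E) 𝓘(ℝ, E) φ (φ.symm y) v)
          (mfderiv 𝓘(ℝ, E) 𝓘(ℝ, E) φ (φ.symm y) w) -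
        fderiv ℝ (formInChart α x₀) y (mfderiv 𝓘(ℝ, E) 𝓘(ℝ, E) φ (φ.symm y) w)
          (mfderiv 𝓘(ℝ, E) 𝓘(ℝ, E) φ (φ.symm y) v) := fun y hy v w => by
    have h := extDerivForm_eq hα.smooth (φ.map_target hy) v w
    rw [φ.right_inv hy] at h
    exact h
  refine contDiffOn_reeb_vector (isOpen_extChartAt_target x₀)
    (contDiffOn_formInChart hα.smooth x₀) (fun y hy => ?_) (fun y hy w => ?_)
    (fun y hy v hv hw => ?_)
  · have h := formInChart_apply_mfderiv (α := α) (φ.map_target hy) (X (φ.symm y))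
    rw [φ.right_inv hy, (hX (φ.symm y)).1] at h
    exact h
  · have h := hBd y hy (X (φ.symm y)) (mfderiv 𝓘(ℝ, E) 𝓘(ℝ, E) φ.symm y w)
    rw [(hX _).2, mfderiv_extChartAt_mfderiv_symm hy] at h
    exact h.symm
  · have hu := hα.nondegenerate (φ.symm y) (mfderiv 𝓘(ℝ, E) 𝓘(ℝ, E) φ.symm y v)
      ((hα.mem_iff _ _).mpr hv) (fun w _ => by
        rw [hBd y hy, mfderiv_extChartAt_mfderiv_symm hy]
        exact hw _)
    rw [← mfderiv_extChartAt_mfderiv_symm hy v]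
    exact (congrArg _ hu).trans (map_zero _)

theorem contMDiff_reebField (hα : IsContactForm ξ α) {X : ∀ x : M, TangentSpace 𝓘(ℝ, E) x}
    (hX : IsReebField α X) :
    ContMDiff 𝓘(ℝ, E) 𝓘(ℝ, E).tangent ∞
      (fun x => (⟨x, X x⟩ : TangentBundle 𝓘(ℝ, E) M)) := by
  intro x₀
  set φ := extChartAt 𝓘(ℝ, E) x₀ with hφ
  have hx₀ : x₀ ∈ φ.source := mem_extChartAt_source x₀
  have h1 := ((contMDiffOn_mfderiv_extChartAt_symm (contDiffOn_reebField hα hX x₀)).contMDiffAt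
    ((isOpen_extChartAt_target x₀).mem_nhds (φ.map_source hx₀))).comp x₀
    (contMDiffAt_extChartAt_of_mem hx₀)
  refine h1.congr_of_eventuallyEq ?_
  filter_upwards [(isOpen_extChartAt_source x₀).mem_nhds hx₀] with x hx
  have hA : ∀ (p : M) (w : E), p = x → w = X x →
      (⟨x, X x⟩ : TangentBundle 𝓘(ℝ, E) M) = ⟨p, w⟩ := by
    rintro p w rfl rfl
    rfl
  refine hA _ _ (φ.left_inv hx) ?_
  have hB : ∀ p : M, p = x → (mfderiv 𝓘(ℝ, E) 𝓘(ℝ, E) φ.symm (φ x)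
      (mfderiv 𝓘(ℝ, E) 𝓘(ℝ, E) φ p (X p)) : E) = X x := by
    rintro p rfl
    exact mfderiv_symm_mfderiv_extChartAt hx (X p)
  exact hB _ (φ.left_inv hx)

end Reeb

/-! ### Invariance of the contact form under the Reeb flow -/

section ReebFlow

open Set Filter Topology

/-- The pullback of `a` under the flow `F` of `V` is infinitesimally constant if `a(V) = 1` and
`da(V, ·) = 0`. -/
theorem hasDerivAt_pullback_flow {E : Type*} [NormedAddCommGroup E] [NormedSpace ℝ E]
    {F : ℝ × E → E} {a : E → E →L[ℝ] ℝ} {V : E → E} {y : E} (hF : ContDiffAt ℝ 2 F (0, y))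
    (hF0 : ∀ᶠ z in 𝓝 y, F (0, z) = z) (hFV : ∀ᶠ z in 𝓝 y, fderiv ℝ F (0, z) (1, 0) = V z)
    (ha : DifferentiableAt ℝ a y) (haV : ∀ᶠ z in 𝓝 y, a z (V z) = 1) {w : E}
    (hd : fderiv ℝ a y (V y) w - fderiv ℝ a y w (V y) = 0) :
    HasDerivAt (fun t => a (F (t, y)) (fderiv ℝ F (t, y) (0, w))) 0 0 := by
  have hF1 : HasFDerivAt F (fderiv ℝ F (0, y)) (0, y) :=
    (hF.differentiableAt (by simp)).hasFDerivAt
  have hF2 : HasFDerivAt (fderiv ℝ F) (fderiv ℝ (fderiv ℝ F) (0, y)) (0, y) :=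
    ((hF.fderiv_right (m := 1) (by norm_num)).differentiableAt (by simp)).hasFDerivAt
  have hsymm := (hF.isSymmSndFDerivAt (by simp)).eq (1, 0) (0, w)
  have hFy : F (0, y) = y := hF0.self_of_nhds
  have hline : HasDerivAt (fun t : ℝ => (t, y)) ((1 : ℝ), (0 : E)) 0 :=
    (hasDerivAt_id (0 : ℝ)).prodMk (hasDerivAt_const (0 : ℝ) y)
  have hslice : HasFDerivAt (fun z : E => ((0 : ℝ), z)) (ContinuousLinearMap.inr ℝ ℝ E) y :=
    hasFDerivAt_prodMk_right 0 y
  have hFw : fderiv ℝ F (0, y) (0, w) = w := by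
    have h1 : HasFDerivAt (fun z => F (0, z)) _ y := hF1.comp y hslice
    have h2 := h1.unique ((hasFDerivAt_id y).congr_of_eventuallyEq hF0)
    exact DFunLike.congr_fun h2 w
  have hFt : HasDerivAt (fun t => F (t, y)) (V y) 0 := by
    have := hF1.comp_hasDerivAt (0 : ℝ) hline
    rwa [hFV.self_of_nhds] at this
  have ha' : HasFDerivAt a (fderiv ℝ a y) (F (0, y)) := by
    rw [hFy]
    exact ha.hasFDerivAt
  have haF : HasDerivAt (fun t => a (F (t, y))) (fderiv ℝ a y (V y)) 0 :=
    ha'.comp_hasDerivAt (0 : ℝ) hFt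
  have hG : HasDerivAt (fun t => fderiv ℝ F (t, y) (0, w))
      (fderiv ℝ (fderiv ℝ F) (0, y) (1, 0) (0, w)) 0 := by
    exact ((ContinuousLinearMap.apply ℝ E ((0 : ℝ), w)).hasFDerivAt).comp_hasDerivAt (0 : ℝ)
      (hF2.comp_hasDerivAt (0 : ℝ) hline)
  have hVd : HasFDerivAt V (((fderiv ℝ (fderiv ℝ F) (0, y)).comp
      (ContinuousLinearMap.inr ℝ ℝ E)).flip (1, 0)) y := by
    have h1 : HasFDerivAt (fun z => fderiv ℝ F (0, z)) _ y := hF2.comp y hslice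
    have h2 : HasFDerivAt (fun z => fderiv ℝ F (0, z) (1, 0)) _ y :=
      ((ContinuousLinearMap.apply ℝ E ((1 : ℝ), (0 : E))).hasFDerivAt).comp y h1
    refine (h2.congr_of_eventuallyEq ?_).congr_fderiv rfl
    filter_upwards [hFV] with z hz
    exact hz.symm
  -- This differentiates `a(V) = 1` in the direction `w`, with `D_w V` a mixed second derivative of
  -- `F`. Subtracting it from the derivative of the pullback leaves `da(V, w) = 0`: Cartan's formula
  -- in coordinates.
  have hone : fderiv ℝ a y w (V y) + a y (fderiv ℝ (fderiv ℝ F) (0, y) (0, w) (1, 0)) = 0 := by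
    have h1 := (ha.hasFDerivAt.clm_apply hVd).unique
      ((hasFDerivAt_const (1 : ℝ) y).congr_of_eventuallyEq haV)
    have h2 := DFunLike.congr_fun h1 w
    simp at h2
    linarith
  refine (haF.clm_apply hG).congr_deriv ?_
  rw [hFw, hFy, hsymm]
  linarith

variable {E : Type u} [NormedAddCommGroup E] [NormedSpace ℝ E] [FiniteDimensional ℝ E]
  {M : Type*} [TopologicalSpace M] [ChartedSpace E M] [IsManifold 𝓘(ℝ, E) ∞ M]
  {α : ∀ x : M, TangentSpace 𝓘(ℝ, E) x →L[ℝ] ℝ}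

theorem hasDerivAt_form_flow_zero
    (hα : ContMDiff (𝓘(ℝ, E).tangent) 𝓘(ℝ, ℝ) ∞
      (fun v : TangentBundle 𝓘(ℝ, E) M => α v.proj v.snd))
    {X : ∀ x : M, TangentSpace 𝓘(ℝ, E) x} (hX : IsReebField α X) {R : ℝ → M → M}
    (hR0 : ∀ x, R 0 x = x) (hRX : ∀ x, IsMIntegralCurve (I := 𝓘(ℝ, E)) (fun s => R s x) X)
    (hR : ContMDiff (𝓘(ℝ, ℝ).prod 𝓘(ℝ, E)) 𝓘(ℝ, E) ∞ (fun q : ℝ × M => R q.1 q.2))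
    (x : M) (v : TangentSpace 𝓘(ℝ, E) x) :
    HasDerivAt (fun t => α (R t x) (mfderiv 𝓘(ℝ, E) 𝓘(ℝ, E) (R t) x v)) 0 0 := by
  set φ := extChartAt 𝓘(ℝ, E) x with hφ
  have hx : x ∈ φ.source := mem_extChartAt_source x
  have hy : φ x ∈ φ.target := φ.map_source hx
  have hyx : φ.symm (φ x) = x := φ.left_inv hx
  have hRt : ∀ t, ContMDiff 𝓘(ℝ, E) 𝓘(ℝ, E) ∞ (R t) := fun t =>
    hR.comp (contMDiff_const.prodMk contMDiff_id)
  set F : ℝ × E → E := fun q => φ (R q.1 (φ.symm q.2)) with hFdef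
  have hFs : ∀ q : ℝ × E, q.2 ∈ φ.target → R q.1 (φ.symm q.2) ∈ φ.source →
      ContDiffAt ℝ ∞ F q := fun q hq hq' => by
    have h1 : ContMDiffAt 𝓘(ℝ, ℝ × E) 𝓘(ℝ, ℝ) ∞ (fun q : ℝ × E => q.1) q :=
      contDiffAt_fst.contMDiffAt
    have h2 : ContMDiffAt 𝓘(ℝ, ℝ × E) 𝓘(ℝ, E) ∞ (fun q : ℝ × E => φ.symm q.2) q :=
      (contMDiffAt_extChartAt_symm hq).comp q contDiffAt_snd.contMDiffAt
    exact ((contMDiffAt_extChartAt_of_mem hq').comp q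
      ((hR _).comp q (h1.prodMk h2))).contDiffAt
  have hV : ∀ z ∈ φ.target, fderiv ℝ F (0, z) (1, 0) =
      mfderiv 𝓘(ℝ, E) 𝓘(ℝ, E) φ (φ.symm z) (X (φ.symm z)) := fun z hz => by
    have hz' : R 0 (φ.symm z) ∈ φ.source := by rw [hR0]; exact φ.map_target hz
    have hline : HasDerivAt (fun t : ℝ => (t, z)) ((1 : ℝ), (0 : E)) 0 :=
      (hasDerivAt_id (0 : ℝ)).prodMk (hasDerivAt_const (0 : ℝ) z)
    have h1 := ((hFs (0, z) hz hz').differentiableAt (by simp)).hasFDerivAt.comp_hasDerivAt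
      (0 : ℝ) hline
    let A : E →L[ℝ] E := mfderiv 𝓘(ℝ, E) 𝓘(ℝ, E) φ (R 0 (φ.symm z))
    let u : E := X (R 0 (φ.symm z))
    have h2 : HasFDerivAt (fun t : ℝ => φ (R t (φ.symm z)))
        (A.comp ((1 : ℝ →L[ℝ] ℝ).smulRight u)) 0 :=
      (((contMDiffAt_extChartAt_of_mem hz').mdifferentiableAt
        (by simp)).hasMFDerivAt.comp (0 : ℝ) (hRX (φ.symm z) 0)).hasFDerivAt
    have h3 : fderiv ℝ F (0, z) (1, 0) = A u := by
      refine (h1.unique h2.hasDerivAt).trans ?_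
      change A ((1 : ℝ) • u) = A u
      rw [one_smul]
    rw [h3]
    simp only [A, u]
    rw [hR0]
    rfl
  have hev : ∀ᶠ t : ℝ in 𝓝 0, R t x ∈ φ.source := by
    refine (hR.continuous.comp (Continuous.prodMk_left x)).continuousAt.eventually_mem ?_
    refine (isOpen_extChartAt_source x).mem_nhds ?_
    simp [hR0]
  have hmain : HasDerivAt (fun t => formInChart α x (F (t, φ x))
      (fderiv ℝ F (t, φ x) (0, mfderiv 𝓘(ℝ, E) 𝓘(ℝ, E) φ x v))) 0 0 := by
    have htar : ∀ᶠ z in 𝓝 (φ x), z ∈ φ.target := (isOpen_extChartAt_target x).mem_nhds hy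
    refine hasDerivAt_pullback_flow
      (V := fun z => mfderiv 𝓘(ℝ, E) 𝓘(ℝ, E) φ (φ.symm z) (X (φ.symm z)))
      ((hFs (0, φ x) hy (by simpa [hR0, hyx] using hx)).of_le (WithTop.coe_le_coe.mpr le_top))
      ?_ ?_ ?_ ?_ ?_
    · filter_upwards [htar] with z hz
      simp only [hFdef, hR0]
      exact φ.right_inv hz
    · filter_upwards [htar] with z hz
      exact hV z hz
    · exact ((contDiffOn_formInChart hα x).contDiffAt htar).differentiableAt (by simp)
    · filter_upwards [htar] with z hz
      have h := formInChart_apply_mfderiv (α := α) (φ.map_target hz) (X (φ.symm z))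
      rw [φ.right_inv hz, (hX (φ.symm z)).1] at h
      exact h
    · have h := (hX (φ.symm (φ x))).2
      rw [hyx] at h ⊢
      exact h v
  refine hmain.congr_of_eventuallyEq ?_
  filter_upwards [hev] with t ht
  have ht' : R t (φ.symm (φ x)) ∈ φ.source := by rwa [hyx]
  have h1 : HasFDerivAt (fun z => F (t, z))
      ((fderiv ℝ F (t, φ x)).comp (ContinuousLinearMap.inr ℝ ℝ E)) (φ x) :=
    ((hFs (t, φ x) hy ht').differentiableAt (by simp)).hasFDerivAt.comp (φ x)
      (hasFDerivAt_prodMk_right t (φ x))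
  have h2 := mfderiv_comp_apply (I := 𝓘(ℝ, E)) (I' := 𝓘(ℝ, E)) (I'' := 𝓘(ℝ, E)) x
    ((contMDiffAt_extChartAt_of_mem ht).mdifferentiableAt (by simp))
    ((hRt t).mdifferentiable (by simp) x) v
  have h3 := mfderiv_comp_apply (I := 𝓘(ℝ, E)) (I' := 𝓘(ℝ, E)) (I'' := 𝓘(ℝ, E)) x
    (g := fun z => F (t, z)) h1.differentiableAt.mdifferentiableAt
    ((contMDiffAt_extChartAt_of_mem hx).mdifferentiableAt (by simp)) v
  have h4 : (fun z => F (t, z)) ∘ φ =ᶠ[𝓝 x] φ ∘ R t := by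
    filter_upwards [(isOpen_extChartAt_source x).mem_nhds hx] with p hp
    exact congrArg (fun p => φ (R t p)) (φ.left_inv hp)
  rw [h4.mfderiv_eq, mfderiv_eq_fderiv, h1.fderiv] at h3
  have h5 : fderiv ℝ F (t, φ x) (0, mfderiv 𝓘(ℝ, E) 𝓘(ℝ, E) φ x v) =
      mfderiv 𝓘(ℝ, E) 𝓘(ℝ, E) φ (R t x) (mfderiv 𝓘(ℝ, E) 𝓘(ℝ, E) (R t) x v) := h3.symm.trans h2
  have h6 : F (t, φ x) = φ (R t x) := congrArg (fun p => φ (R t p)) hyx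
  rw [h5, h6]
  exact (formInChart_apply_mfderiv ht _).symm

/-- Writing `R_s = R_{s-t} ∘ R_t` moves the vanishing derivative from time `0` to every time `t`, so
the pullback of `α` is constant in time. -/
theorem form_flow_eq
    (hα : ContMDiff (𝓘(ℝ, E).tangent) 𝓘(ℝ, ℝ) ∞
      (fun v : TangentBundle 𝓘(ℝ, E) M => α v.proj v.snd))
    {X : ∀ x : M, TangentSpace 𝓘(ℝ, E) x} (hX : IsReebField α X) {R : ℝ → M → M}
    (hR0 : ∀ x, R 0 x = x) (hRadd : ∀ s t x, R (s + t) x = R s (R t x))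
    (hRX : ∀ x, IsMIntegralCurve (I := 𝓘(ℝ, E)) (fun s => R s x) X)
    (hR : ContMDiff (𝓘(ℝ, ℝ).prod 𝓘(ℝ, E)) 𝓘(ℝ, E) ∞ (fun q : ℝ × M => R q.1 q.2))
    (t : ℝ) (x : M) (v : TangentSpace 𝓘(ℝ, E) x) :
    α (R t x) (mfderiv 𝓘(ℝ, E) 𝓘(ℝ, E) (R t) x v) = α x v := by
  have hRt : ∀ t, ContMDiff 𝓘(ℝ, E) 𝓘(ℝ, E) ∞ (R t) := fun t =>
    hR.comp (contMDiff_const.prodMk contMDiff_id)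
  have hd : ∀ t, HasDerivAt (fun t => α (R t x) (mfderiv 𝓘(ℝ, E) 𝓘(ℝ, E) (R t) x v)) 0 t := by
    intro t
    have h1 : ∀ r, r = 0 → HasDerivAt (fun s => α (R s (R t x))
        (mfderiv 𝓘(ℝ, E) 𝓘(ℝ, E) (R s) (R t x) (mfderiv 𝓘(ℝ, E) 𝓘(ℝ, E) (R t) x v))) 0 r := by
      rintro _ rfl
      exact hasDerivAt_form_flow_zero hα hX hR0 hRX hR (R t x) _
    refine ((h1 _ (sub_self t)).comp_sub_const t t).congr_of_eventuallyEq (Eventually.of_forall fun s => ?_)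
    have h2 : R s = R (s - t) ∘ R t := by
      ext z
      rw [Function.comp, ← hRadd, sub_add_cancel]
    have h3 := mfderiv_comp_apply (I := 𝓘(ℝ, E)) (I' := 𝓘(ℝ, E)) (I'' := 𝓘(ℝ, E)) x
      ((hRt (s - t)).mdifferentiable (by simp) (R t x)) ((hRt t).mdifferentiable (by simp) x) v
    change α (R s x) (mfderiv 𝓘(ℝ, E) 𝓘(ℝ, E) (R s) x v) = _
    rw [h2]
    exact congrArg (α (R (s - t) (R t x))) h3
  have h1 := is_const_of_deriv_eq_zero (fun t => (hd t).differentiableAt) (fun t => (hd t).deriv)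
    t 0
  have h2 : R 0 = id := funext hR0
  rw [h2, mfderiv_id] at h1
  exact h1

end ReebFlow

/-! ### Velocities and Hamiltonians of products and reparametrizations -/

section Families

open Set

variable {E : Type*} [NormedAddCommGroup E] [NormedSpace ℝ E]
  {M : Type*} [TopologicalSpace M] [ChartedSpace E M]
  {ξ : ∀ x : M, Submodule ℝ (TangentSpace 𝓘(ℝ, E) x)}

namespace ContactFamily

variable {P : Type*} [NormedAddCommGroup P] [NormedSpace ℝ P]
  {Q : Type*} [NormedAddCommGroup Q] [NormedSpace ℝ Q]

/-- The family `q ↦ φ_{u(q)}`. -/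
noncomputable def comp (φ : ContactFamily ξ P) (u : Q → P) (hu : ContDiff ℝ ∞ u) :
    ContactFamily ξ Q where
  toFun q := φ.toFun (u q)
  invFun q := φ.invFun (u q)
  left_inv q := φ.left_inv (u q)
  right_inv q := φ.right_inv (u q)
  smooth_toFun := φ.smooth_toFun.comp ((hu.contMDiff.comp contMDiff_fst).prodMk contMDiff_snd)
  smooth_invFun := φ.smooth_invFun.comp ((hu.contMDiff.comp contMDiff_fst).prodMk contMDiff_snd)
  contact q := φ.contact (u q)
  compact_support := by
    obtain ⟨K, hK, h⟩ := φ.compact_support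
    exact ⟨K, hK, fun q => h (u q)⟩

@[simp]
theorem comp_toFun (φ : ContactFamily ξ P) (u : Q → P) (hu : ContDiff ℝ ∞ u) (q : Q) (x : M) :
    (φ.comp u hu).toFun q x = φ.toFun (u q) x := rfl

@[simp]
theorem mul_toFun (φ ψ : ContactFamily ξ P) (p : P) (x : M) :
    (φ * ψ).toFun p x = φ.toFun p (ψ.toFun p x) := rfl

@[simp]
theorem inv_toFun (φ : ContactFamily ξ P) (p : P) (x : M) : φ⁻¹.toFun p x = φ.invFun p x := rfl

/-- The velocity `d/dt φ_t (x)`. -/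
noncomputable def velocity (φ : ContactFamily ξ ℝ) (t : ℝ) (x : M) :
    TangentSpace 𝓘(ℝ, E) (φ.toFun t x) :=
  mfderiv 𝓘(ℝ, ℝ) 𝓘(ℝ, E) (fun s : ℝ => φ.toFun s x) t (1 : ℝ)

/-- The value `α (d/dt φ_t (x))` of the Hamiltonian at `φ_t (x)`. -/
noncomputable def energy (α : ∀ x : M, TangentSpace 𝓘(ℝ, E) x →L[ℝ] ℝ) (φ : ContactFamily ξ ℝ)
    (t : ℝ) (x : M) : ℝ :=
  α (φ.toFun t x) (φ.velocity t x)

theorem mdifferentiable_curve (φ : ContactFamily ξ ℝ) (x : M) :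
    MDifferentiable 𝓘(ℝ, ℝ) 𝓘(ℝ, E) (fun s : ℝ => φ.toFun s x) :=
  (φ.smooth_toFun.comp (contMDiff_id.prodMk contMDiff_const)).mdifferentiable (by simp)

theorem velocity_mul (φ ψ : ContactFamily ξ ℝ) (t : ℝ) (x : M) :
    ((φ * ψ).velocity t x : E) = (φ.velocity t (ψ.toFun t x) : E) +
      (mfderiv 𝓘(ℝ, E) 𝓘(ℝ, E) (φ.toFun t) (ψ.toFun t x) (ψ.velocity t x) : E) := by
  have h1 := mfderiv_comp_apply (I := 𝓘(ℝ, ℝ)) (I' := 𝓘(ℝ, ℝ).prod 𝓘(ℝ, E)) (I'' := 𝓘(ℝ, E)) t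
    (g := fun q : ℝ × M => φ.toFun q.1 q.2) (f := fun s => (s, ψ.toFun s x))
    (φ.smooth_toFun.mdifferentiable (by simp) _)
    (mdifferentiableAt_id.prodMk (ψ.mdifferentiable_curve x t)) (1 : ℝ)
  rw [mfderiv_prod_eq_add_apply (φ.smooth_toFun.mdifferentiable (by simp) _)] at h1
  have h2 : (mfderiv 𝓘(ℝ, ℝ) (𝓘(ℝ, ℝ).prod 𝓘(ℝ, E)) (fun s => (s, ψ.toFun s x)) t (1 : ℝ) :
      ℝ × E) = (1, ψ.velocity t x) := by
    have h3 := mfderiv_prodMk (mdifferentiableAt_id (I := 𝓘(ℝ, ℝ)) (x := t))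
      (ψ.mdifferentiable_curve x t)
    rw [mfderiv_id] at h3
    exact DFunLike.congr_fun h3 (1 : ℝ)
  let A : ℝ →L[ℝ] E := mfderiv 𝓘(ℝ, ℝ) 𝓘(ℝ, E) (fun s => φ.toFun s (ψ.toFun t x)) t
  let B : E →L[ℝ] E := mfderiv 𝓘(ℝ, E) 𝓘(ℝ, E) (φ.toFun t) (ψ.toFun t x)
  exact h1.trans (congrArg (fun w : ℝ × E => A w.1 + B w.2) h2)

theorem velocity_comp (φ : ContactFamily ξ ℝ) (u : ℝ → ℝ) (hu : ContDiff ℝ ∞ u) (t : ℝ) (x : M) :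
    ((φ.comp u hu).velocity t x : E) = deriv u t • (φ.velocity (u t) x : E) := by
  have h1 := mfderiv_comp_apply (I := 𝓘(ℝ, ℝ)) (I' := 𝓘(ℝ, ℝ)) (I'' := 𝓘(ℝ, E)) t
    (g := fun s => φ.toFun s x) (f := u) (φ.mdifferentiable_curve x (u t))
    (hu.contMDiff.mdifferentiable (by simp) t) (1 : ℝ)
  let A : ℝ →L[ℝ] E := mfderiv 𝓘(ℝ, ℝ) 𝓘(ℝ, E) (fun s => φ.toFun s x) (u t)
  have h2 : (mfderiv 𝓘(ℝ, ℝ) 𝓘(ℝ, ℝ) u t (1 : ℝ) : ℝ) = deriv u t :=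
    (DFunLike.congr_fun (mfderiv_eq_fderiv (𝕜 := ℝ) (f := u) (x := t)) (1 : ℝ)).trans
      (fderiv_apply_one_eq_deriv (𝕜 := ℝ) (f := u) (x := t))
  refine h1.trans ((congrArg A h2).trans ?_)
  rw [← mul_one (deriv u t), ← smul_eq_mul, map_smul, smul_eq_mul, mul_one]
  rfl

variable {α : ∀ x : M, TangentSpace 𝓘(ℝ, E) x →L[ℝ] ℝ}

theorem energy_mul (φ ψ : ContactFamily ξ ℝ) (t : ℝ) (x : M) :
    (φ * ψ).energy α t x = φ.energy α t (ψ.toFun t x) + α (φ.toFun t (ψ.toFun t x))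
      (mfderiv 𝓘(ℝ, E) 𝓘(ℝ, E) (φ.toFun t) (ψ.toFun t x) (ψ.velocity t x)) :=
  (congrArg (α (φ.toFun t (ψ.toFun t x))) (velocity_mul φ ψ t x)).trans (map_add _ _ _)

theorem energy_comp (φ : ContactFamily ξ ℝ) (u : ℝ → ℝ) (hu : ContDiff ℝ ∞ u) (t : ℝ) (x : M) :
    (φ.comp u hu).energy α t x = deriv u t * φ.energy α (u t) x :=
  (congrArg (α (φ.toFun (u t) x)) (velocity_comp φ u hu t x)).trans (map_smul _ _ _)

/-- If `ψ` is stationary at time `t`, it contributes nothing to the Hamiltonian of `φ ψ`. -/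
theorem energy_mul_of_deriv_eq_zero (φ ψ : ContactFamily ξ ℝ) {u : ℝ → ℝ} (hu : ContDiff ℝ ∞ u)
    {t : ℝ} (ht : deriv u t = 0) (x : M) :
    (φ * ψ.comp u hu).energy α t x = φ.energy α t (ψ.toFun (u t) x) := by
  have h : (ψ.comp u hu).velocity t x = 0 := by
    have := velocity_comp ψ u hu t x
    rwa [ht, zero_smul] at this
  rw [energy_mul, h, map_zero, map_zero, add_zero]
  rfl

/-- If `φ_t` preserves `α`, the Hamiltonians of `φ` and `ψ` add up in `φ ψ`. -/
theorem energy_mul_of_preserves (φ ψ : ContactFamily ξ ℝ) {t : ℝ}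
    (h : ∀ (p : M) (v : TangentSpace 𝓘(ℝ, E) p),
      α (φ.toFun t p) (mfderiv 𝓘(ℝ, E) 𝓘(ℝ, E) (φ.toFun t) p v) = α p v) (x : M) :
    (φ * ψ).energy α t x = φ.energy α t (ψ.toFun t x) + ψ.energy α t x := by
  rw [energy_mul, h]
  rfl

theorem energy_eq_zero (φ : ContactFamily ξ ℝ) {x : M}
    (h : ∀ t, φ.toFun t x = x) (t : ℝ) : φ.energy α t x = 0 := by
  have h1 : (fun s : ℝ => φ.toFun s x) = fun _ => x := funext h
  have h2 : φ.velocity t x = 0 := by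
    rw [velocity, h1, mfderiv_const]
    rfl
  rw [energy, h2, map_zero]

theorem preserves_of_eq_id (φ : ContactFamily ξ P) {p : P} (h : ∀ x, φ.toFun p x = x) (x : M)
    (v : TangentSpace 𝓘(ℝ, E) x) :
    α (φ.toFun p x) (mfderiv 𝓘(ℝ, E) 𝓘(ℝ, E) (φ.toFun p) x v) = α x v := by
  have hid : φ.toFun p = id := funext h
  rw [hid, mfderiv_id]
  rfl

end ContactFamily

namespace ContactIsotopy

variable {α : ∀ x : M, TangentSpace 𝓘(ℝ, E) x →L[ℝ] ℝ}

theorem hamiltonian_toFun (φ : ContactIsotopy ξ) (t : ℝ) (x : M) :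
    φ.hamiltonian α t (φ.toFun t x) = φ.energy α t x := by
  rw [hamiltonian, φ.left_inv]
  rfl

/-- Since `φ_t` is a bijection, pointwise conditions on the Hamiltonian may be checked along
trajectories, where no inverse map appears. -/
theorem forall_hamiltonian_iff (φ : ContactIsotopy ξ) (t : ℝ) (p : ℝ → Prop) :
    (∀ y, p (φ.hamiltonian α t y)) ↔ ∀ x, p (φ.energy α t x) := by
  constructor
  · intro h x
    rw [← hamiltonian_toFun]
    exact h _
  · intro h y
    rw [← φ.right_inv t y, hamiltonian_toFun]
    exact h _

end ContactIsotopy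

end Families

/-! ### Lower bounds: reversal, conjugation, concatenation -/

section LowerBounds

open Set

variable {E : Type*} [NormedAddCommGroup E] [NormedSpace ℝ E]
  {M : Type*} [TopologicalSpace M] [ChartedSpace E M]
  {ξ : ∀ x : M, Submodule ℝ (TangentSpace 𝓘(ℝ, E) x)}
  {α : ∀ x : M, TangentSpace 𝓘(ℝ, E) x →L[ℝ] ℝ}

/-- `u` is represented by a contact isotopy with Hamiltonian `≥ c`. -/
def HasLowerBound (α : ∀ x : M, TangentSpace 𝓘(ℝ, E) x →L[ℝ] ℝ) (c : ℝ) (u : UCont ξ) : Prop :=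
  ∃ φ : ContactIsotopy ξ,
    (∀ t ∈ Icc (0 : ℝ) 1, ∀ x, c ≤ φ.energy α t x) ∧ UCont.mk φ = u

theorem HasLowerBound.mono {c c' : ℝ} {u : UCont ξ} (h : HasLowerBound α c u) (hc : c' ≤ c) :
    HasLowerBound α c' u := by
  obtain ⟨φ, hφ, rfl⟩ := h
  exact ⟨φ, fun t ht x => hc.trans (hφ t ht x), rfl⟩

theorem UCont.mk_eq_mk {φ ψ : ContactIsotopy ξ} (Φ : ContactFamily ξ (ℝ × ℝ))
    (h0 : ∀ s x, Φ.toFun (s, 0) x = x) (h1 : ∀ s x, Φ.toFun (s, 1) x = φ.toFun 1 x)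
    (hφ : ∀ t x, Φ.toFun (0, t) x = φ.toFun t x) (hψ : ∀ t x, Φ.toFun (1, t) x = ψ.toFun t x) :
    UCont.mk φ = UCont.mk ψ :=
  Quot.sound ⟨Φ, fun s _ => h0 s, fun s _ => h1 s, fun t _ => hφ t, fun t _ => hψ t⟩

theorem UCont.mk_mul (φ ψ : ContactIsotopy ξ) : UCont.mk (φ * ψ) = UCont.mk φ * UCont.mk ψ := rfl

theorem UCont.mk_inv (φ : ContactIsotopy ξ) : UCont.mk φ⁻¹ = (UCont.mk φ)⁻¹ := rfl

theorem UCont.exists_mk (u : UCont ξ) : ∃ φ : ContactIsotopy ξ, UCont.mk φ = u := by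
  obtain ⟨φ⟩ := u
  exact ⟨φ, rfl⟩

namespace ContactIsotopy

/-- The reparametrized isotopy `t ↦ φ_{β(t)}`. -/
noncomputable def reparam (φ : ContactIsotopy ξ) (β : ℝ → ℝ) (hβ : ContDiff ℝ ∞ β)
    (h0 : β 0 = 0) : ContactIsotopy ξ where
  toContactFamily := φ.toContactFamily.comp β hβ
  map_zero x := by rw [ContactFamily.comp_toFun, h0, φ.map_zero]

/-- The homotopy interpolates linearly between the time changes `β` and `id`. -/
theorem mk_reparam (φ : ContactIsotopy ξ) (β : ℝ → ℝ) (hβ : ContDiff ℝ ∞ β) (h0 : β 0 = 0)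
    (h1 : β 1 = 1) : UCont.mk (φ.reparam β hβ h0) = UCont.mk φ := by
  refine UCont.mk_eq_mk (φ.toContactFamily.comp
    (fun p : ℝ × ℝ => (1 - p.1) * β p.2 + p.1 * p.2) (by fun_prop))
    (fun s x => ?_) (fun s x => ?_) (fun t x => ?_) (fun t x => ?_)
  · simp [h0, φ.map_zero]
  · simp [reparam, h1]
  · simp [reparam]
  · simp

/-- The reversed isotopy `t ↦ φ_{1-t} φ_1⁻¹`. -/
noncomputable def reverse (φ : ContactIsotopy ξ) : ContactIsotopy ξ where
  toContactFamily := φ.toContactFamily.comp (fun t => 1 - t) (by fun_prop) *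
    φ.toContactFamily⁻¹.comp (fun _ => 1) contDiff_const
  map_zero x := by simp [φ.right_inv]

/-- The homotopy `φ_{s(1-t)} φ_{s+(1-s)t}⁻¹` joins the pointwise inverse, at `s = 0`, to the
reversed isotopy, at `s = 1`. -/
theorem mk_reverse (φ : ContactIsotopy ξ) : UCont.mk φ.reverse = (UCont.mk φ)⁻¹ := by
  rw [← UCont.mk_inv]
  refine (UCont.mk_eq_mk (φ.toContactFamily.comp
      (fun p : ℝ × ℝ => p.1 * (1 - p.2)) (by fun_prop) *
    φ.toContactFamily⁻¹.comp (fun p : ℝ × ℝ => p.1 + (1 - p.1) * p.2) (by fun_prop))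
    (fun s x => ?_) (fun s x => ?_) (fun t x => ?_) (fun t x => ?_)).symm
  · simp [φ.right_inv]
  · simp [φ.map_zero]
    rfl
  · simp [φ.map_zero]
    rfl
  · simp [reverse]

theorem energy_reverse (φ : ContactIsotopy ξ) (t : ℝ) (x : M) :
    φ.reverse.energy α t x = - φ.energy α (1 - t) (φ.invFun 1 x) := by
  refine (ContactFamily.energy_mul_of_deriv_eq_zero _ _ contDiff_const (by simp) x).trans ?_
  rw [ContactFamily.energy_comp]
  simp

/-- The conjugate `t ↦ θ_1⁻¹ φ_t θ_1`. -/
noncomputable def conj (θ φ : ContactIsotopy ξ) : ContactIsotopy ξ where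
  toContactFamily := θ.toContactFamily⁻¹.comp (fun _ => 1) contDiff_const *
    (φ.toContactFamily * θ.toContactFamily.comp (fun _ => 1) contDiff_const)
  map_zero x := by simp [φ.map_zero, θ.left_inv]

/-- In `θ_t⁻¹ φ_t θ_t` the index of `θ` is pushed from `t` to `1` through `t + s(1-t)`. At `t = 0`
the two factors of `θ` cancel, so the endpoints stay fixed. -/
theorem mk_conj (θ φ : ContactIsotopy ξ) :
    UCont.mk (θ.conj φ) = (UCont.mk θ)⁻¹ * UCont.mk φ * UCont.mk θ := by
  rw [← UCont.mk_inv, ← UCont.mk_mul, ← UCont.mk_mul, mul_assoc]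
  refine (UCont.mk_eq_mk (θ.toContactFamily⁻¹.comp
      (fun p : ℝ × ℝ => p.2 + p.1 * (1 - p.2)) (by fun_prop) *
    (φ.toContactFamily.comp (fun p : ℝ × ℝ => p.2) (by fun_prop) *
      θ.toContactFamily.comp (fun p : ℝ × ℝ => p.2 + p.1 * (1 - p.2)) (by fun_prop)))
    (fun s x => ?_) (fun s x => ?_) (fun t x => ?_) (fun t x => ?_)).symm
  · simp [φ.map_zero, θ.left_inv]
  · simp
    rfl
  · simp
    rfl
  · simp [conj]

/-- The energies of the two sides of `θ_1 (θ_1⁻¹ φ_t θ_1) = φ_t θ_1` are compared; the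
time-independent factor `θ_1` contributes no velocity of its own. -/
theorem energy_conj (θ φ : ContactIsotopy ξ) (t : ℝ) (x : M) :
    (θ.conj φ).energy (pullbackForm (θ.toFun 1) α) t x = φ.energy α t (θ.toFun 1 x) := by
  set θc : ContactFamily ξ ℝ := θ.toContactFamily.comp (fun _ => 1) contDiff_const
  have h1 : θc * (θ.conj φ).toContactFamily = φ.toContactFamily * θc := by
    ext t x
    · exact θ.right_inv 1 _
    · exact congrArg ((φ.toContactFamily * θc).invFun t) (θ.right_inv 1 x)
  have h2 := ContactFamily.energy_mul (α := α) θc (θ.conj φ).toContactFamily t x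
  rw [h1, ContactFamily.energy_mul_of_deriv_eq_zero _ _ contDiff_const (by simp),
    ContactFamily.energy_comp] at h2
  simp only [deriv_const, zero_mul, zero_add] at h2
  exact h2.symm

end ContactIsotopy

theorem hasLowerBound_inv_iff {c : ℝ} {u : UCont ξ} :
    HasLowerBound α c u⁻¹ ↔ ∃ φ : ContactIsotopy ξ,
      (∀ t ∈ Icc (0 : ℝ) 1, ∀ x, φ.energy α t x ≤ -c) ∧ UCont.mk φ = u := by
  have hI : ∀ t ∈ Icc (0 : ℝ) 1, 1 - t ∈ Icc (0 : ℝ) 1 := fun t ht =>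
    ⟨sub_nonneg.mpr ht.2, sub_le_self _ ht.1⟩
  constructor
  · rintro ⟨φ, hφ, h⟩
    refine ⟨φ.reverse, fun t ht x => ?_, by rw [φ.mk_reverse, h, inv_inv]⟩
    rw [φ.energy_reverse]
    exact neg_le_neg (hφ _ (hI t ht) _)
  · rintro ⟨φ, hφ, rfl⟩
    refine ⟨φ.reverse, fun t ht x => ?_, φ.mk_reverse⟩
    rw [φ.energy_reverse]
    exact le_neg_of_le_neg (hφ _ (hI t ht) _)

theorem HasLowerBound.conj {c : ℝ} {u f : UCont ξ} (h : HasLowerBound α c u) :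
    HasLowerBound (pullbackForm f.proj α) c (f⁻¹ * u * f) := by
  obtain ⟨θ, rfl⟩ := f.exists_mk
  obtain ⟨φ, hφ, rfl⟩ := h
  refine ⟨θ.conj φ, fun t ht x => ?_, θ.mk_conj φ⟩
  exact (hφ t ht _).trans (θ.energy_conj φ t x).ge

theorem pullbackForm_inv_proj (f : UCont ξ) :
    pullbackForm f⁻¹.proj (pullbackForm f.proj α) = α := by
  obtain ⟨θ, rfl⟩ := f.exists_mk
  ext x v
  have h : ∀ (p : M) (w : TangentSpace 𝓘(ℝ, E) p), p = x → (w : E) = v → α p w = α x v := by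
    rintro p w rfl rfl
    rfl
  exact h _ _ (θ.right_inv 1 x) (θ.mfderiv_toFun_invFun 1 x v)

theorem hasLowerBound_conj_iff {c : ℝ} {u f : UCont ξ} :
    HasLowerBound (pullbackForm f.proj α) c (f⁻¹ * u * f) ↔ HasLowerBound α c u := by
  refine ⟨fun h => ?_, HasLowerBound.conj⟩
  have h1 := h.conj (f := f⁻¹)
  rw [pullbackForm_inv_proj] at h1
  convert! h1 using 1
  group

/-- A smooth monotone step with slope at most `1 + η`. -/
theorem exists_smooth_step {η : ℝ} (hη : 0 < η) :
    ∃ σ : ℝ → ℝ, ContDiff ℝ ∞ σ ∧ (∀ t ≤ 0, σ t = 0) ∧ (∀ t, 1 ≤ t → σ t = 1) ∧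
      (∀ t, 0 ≤ deriv σ t) ∧ (∀ t, deriv σ t ≤ 1 + η) ∧ (∀ t ≤ 0, deriv σ t = 0) ∧
      (∀ t, 1 ≤ t → deriv σ t = 0) := by
  -- This `δ` gives the plateau `[δ, 1 - δ]` of the bump `k ≤ 1` length `1 / (1 + η)`. The integral
  -- `J` is at least that, so the normalized primitive has slope at most `1 + η`.
  set δ := η / (2 * (1 + η)) with hδ
  have hδ0 : 0 < δ := by positivity
  have hδ1 : 1 - 2 * δ = (1 + η)⁻¹ := by
    rw [hδ]
    field_simp
    ring
  have hδ2 : δ ≤ 1 - δ := by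
    have : 0 < (1 + η)⁻¹ := by positivity
    linarith
  set k : ℝ → ℝ := fun t =>
    Real.smoothTransition (t / δ) * Real.smoothTransition ((1 - t) / δ) with hk
  have hks : ContDiff ℝ ∞ k :=
    (Real.smoothTransition.contDiff.comp (contDiff_id.div_const δ)).mul
      (Real.smoothTransition.contDiff.comp ((contDiff_const.sub contDiff_id).div_const δ))
  have hk0 : ∀ t, 0 ≤ k t := fun t =>
    mul_nonneg (Real.smoothTransition.nonneg _) (Real.smoothTransition.nonneg _)
  have hk1 : ∀ t, k t ≤ 1 := fun t =>
    mul_le_one₀ (Real.smoothTransition.le_one _) (Real.smoothTransition.nonneg _)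
      (Real.smoothTransition.le_one _)
  have hkl : ∀ t ≤ 0, k t = 0 := fun t ht => by
    simp only [hk]
    rw [Real.smoothTransition.zero_of_nonpos (div_nonpos_of_nonpos_of_nonneg ht hδ0.le), zero_mul]
  have hkr : ∀ t, 1 ≤ t → k t = 0 := fun t ht => by
    simp only [hk]
    rw [Real.smoothTransition.zero_of_nonpos
      (div_nonpos_of_nonpos_of_nonneg (sub_nonpos.mpr ht) hδ0.le) (x := (1 - t) / δ), mul_zero]
  have hint : ∀ a b, IntervalIntegrable k MeasureTheory.volume a b :=
    fun a b => hks.continuous.intervalIntegrable a b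
  set J := ∫ t in (0 : ℝ)..1, k t with hJ
  have hJl : (1 + η)⁻¹ ≤ J := by
    have h1 : ∫ t in δ..(1 - δ), k t = 1 - δ - δ := by
      rw [intervalIntegral.integral_congr (g := fun _ => (1 : ℝ))]
      · simp
      · intro t ht
        rw [uIcc_of_le hδ2] at ht
        simp only [hk]
        rw [Real.smoothTransition.one_of_one_le ((one_le_div hδ0).mpr ht.1),
          Real.smoothTransition.one_of_one_le ((one_le_div hδ0).mpr (by linarith [ht.2])), mul_one]
    have h2 : ∫ t in δ..(1 - δ), k t ≤ J :=
      intervalIntegral.integral_mono_interval hδ0.le hδ2 (by linarith)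
        (Filter.Eventually.of_forall hk0) (hint 0 1)
    linarith
  have hJ0 : 0 < J := lt_of_lt_of_le (by positivity) hJl
  have hder : ∀ t, HasDerivAt (fun t => J⁻¹ * ∫ u in (0 : ℝ)..t, k u) (J⁻¹ * k t) t := fun t =>
    (hks.continuous.integral_hasStrictDerivAt 0 t).hasDerivAt.const_mul _
  have hderiv : deriv (fun t => J⁻¹ * ∫ u in (0 : ℝ)..t, k u) = fun t => J⁻¹ * k t :=
    funext fun t => (hder t).deriv
  refine ⟨fun t => J⁻¹ * ∫ u in (0 : ℝ)..t, k u, ?_, ?_, ?_, ?_, ?_, ?_, ?_⟩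
  · rw [contDiff_infty_iff_deriv, hderiv]
    exact ⟨fun t => (hder t).differentiableAt, contDiff_const.mul hks⟩
  · intro t ht
    have h1 : ∫ u in (0 : ℝ)..t, k u = 0 := by
      refine intervalIntegral.integral_zero_ae (Filter.Eventually.of_forall fun u hu => ?_)
      rw [uIoc_of_ge ht] at hu
      exact hkl u hu.2
    simp only [h1, mul_zero]
  · intro t ht
    have h1 : ∫ u in (1 : ℝ)..t, k u = 0 := by
      refine intervalIntegral.integral_zero_ae (Filter.Eventually.of_forall fun u hu => ?_)
      rw [uIoc_of_le ht] at hu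
      exact hkr u hu.1.le
    have h2 := intervalIntegral.integral_add_adjacent_intervals (hint 0 1) (hint 1 t)
    rw [h1, add_zero] at h2
    simp only [← h2]
    exact inv_mul_cancel₀ hJ0.ne'
  · intro t
    rw [hderiv]
    exact mul_nonneg (inv_nonneg.mpr hJ0.le) (hk0 t)
  · intro t
    rw [hderiv]
    refine (mul_le_of_le_one_right (inv_nonneg.mpr hJ0.le) (hk1 t)).trans ?_
    rw [inv_le_comm₀ hJ0 (by linarith)]
    exact hJl
  · intro t ht
    rw [hderiv]
    simp only [hkl t ht, mul_zero]
  · intro t ht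
    rw [hderiv]
    simp only [hkr t ht, mul_zero]

/-- Concatenation of isotopies. -/
theorem HasLowerBound.mul {a b c : ℝ} {u v : UCont ξ} (hu : HasLowerBound α a u)
    (hv : HasLowerBound α b v) (ha : a < 0) (hb : b < 0) (hc : c < a + b) :
    HasLowerBound α c (u * v) := by
  obtain ⟨φ, hφ, rfl⟩ := hu
  obtain ⟨ψ, hψ, rfl⟩ := hv
  have hab : a + b < 0 := add_neg ha hb
  -- Here `η > 0` because `c < a + b < 0`; the slope of `σ` is then at most `c / (a + b)`.
  obtain ⟨σ, hσ, hσ0, hσ1, hσd, hσd', hσd0, hσd1⟩ :=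
    exists_smooth_step (η := c / (a + b) - 1) (by rw [sub_pos, lt_div_iff_of_neg hab]; linarith)
  have hσd2 : ∀ t, deriv σ t ≤ c / (a + b) := fun t => by linarith [hσd' t]
  have hmono : Monotone σ := monotone_of_deriv_nonneg (hσ.differentiable (by simp)) hσd
  have hσI : ∀ t, σ t ∈ Icc (0 : ℝ) 1 := fun t => by
    refine ⟨?_, ?_⟩
    · rw [← hσ0 (min t 0) (min_le_right _ _)]
      exact hmono (min_le_left _ _)
    · rw [← hσ1 (max t 1) (le_max_right _ _)]
      exact hmono (le_max_left _ _)
  -- `ψ` runs during `[0, l]` and `φ` during `[l, 1]`. With this share the speeds are at most `c /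
  -- b` and `c / a`, so both Hamiltonians stay above `c`. Negativity of `a` and `b` turns upper
  -- bounds on speed into lower bounds on energy.
  set l := b / (a + b) with hl
  have hl0 : 0 < l := div_pos_of_neg_of_neg hb hab
  have hl1 : 1 - l = a / (a + b) := by
    rw [hl, eq_div_iff hab.ne, sub_mul, div_mul_cancel₀ _ hab.ne]
    ring
  have hl1' : 0 < 1 - l := hl1 ▸ div_pos_of_neg_of_neg ha hab
  have hβ₁ : ContDiff ℝ ∞ (fun t : ℝ => σ (l⁻¹ * t)) := hσ.comp (by fun_prop)
  have hβ₂ : ContDiff ℝ ∞ (fun t : ℝ => σ ((1 - l)⁻¹ * (t - l))) := hσ.comp (by fun_prop)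
  have hd₁ : ∀ t, deriv (fun t : ℝ => σ (l⁻¹ * t)) t = deriv σ (l⁻¹ * t) * l⁻¹ := fun t => by
    have h1 : HasDerivAt (fun t : ℝ => l⁻¹ * t) l⁻¹ t := by
      simpa using (hasDerivAt_id t).const_mul l⁻¹
    exact ((hσ.differentiable (by simp) _).hasDerivAt.comp t h1).deriv
  have hd₂ : ∀ t, deriv (fun t : ℝ => σ ((1 - l)⁻¹ * (t - l))) t =
      deriv σ ((1 - l)⁻¹ * (t - l)) * (1 - l)⁻¹ := fun t => by
    have h1 : HasDerivAt (fun t : ℝ => (1 - l)⁻¹ * (t - l)) (1 - l)⁻¹ t := by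
      simpa using ((hasDerivAt_id t).sub_const l).const_mul (1 - l)⁻¹
    exact ((hσ.differentiable (by simp) _).hasDerivAt.comp t h1).deriv
  have h₁0 : σ (l⁻¹ * 0) = 0 := hσ0 _ (by simp)
  have h₁1 : σ (l⁻¹ * 1) = 1 := hσ1 _ (by rw [mul_one, one_le_inv₀ hl0]; linarith)
  have h₂0 : σ ((1 - l)⁻¹ * (0 - l)) = 0 :=
    hσ0 _ (mul_nonpos_of_nonneg_of_nonpos (inv_nonneg.mpr hl1'.le) (by linarith))
  have h₂1 : σ ((1 - l)⁻¹ * (1 - l)) = 1 := hσ1 _ (by rw [inv_mul_cancel₀ hl1'.ne'])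
  have hbound : ∀ {d e s w : ℝ}, d < 0 → d ≤ e → 0 < s → s = d / (a + b) →
      c ≤ deriv σ w * s⁻¹ * e := fun {d e s w} hd he hs hs' => by
    have h1 : c = c / (a + b) * s⁻¹ * d := by
      rw [hs', inv_div]
      field_simp [hab.ne, hd.ne]
    have h2 : deriv σ w * s⁻¹ * d ≤ deriv σ w * s⁻¹ * e :=
      mul_le_mul_of_nonneg_left he (mul_nonneg (hσd w) (inv_nonneg.mpr hs.le))
    have h3 : c / (a + b) * s⁻¹ * d ≤ deriv σ w * s⁻¹ * d :=
      mul_le_mul_of_nonpos_right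
        (mul_le_mul_of_nonneg_right (hσd2 w) (inv_nonneg.mpr hs.le)) hd.le
    linarith
  refine ⟨φ.reparam _ hβ₂ h₂0 * ψ.reparam _ hβ₁ h₁0, fun t ht x => ?_, ?_⟩
  · change c ≤ (φ.toContactFamily.comp _ hβ₂ * ψ.toContactFamily.comp _ hβ₁).energy α t x
    -- Before `l` the factor `φ` is stationary at the identity, which preserves `α`; after `l` the
    -- factor `ψ` is stationary. Only one factor contributes at a time.
    rcases le_total t l with htl | htl
    · have hneg : (1 - l)⁻¹ * (t - l) ≤ 0 :=
        mul_nonpos_of_nonneg_of_nonpos (inv_nonneg.mpr hl1'.le) (by linarith)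
      rw [ContactFamily.energy_mul_of_preserves, ContactFamily.energy_comp,
        ContactFamily.energy_comp, hd₁, hd₂, hσd0 _ hneg]
      · rw [zero_mul, zero_mul, zero_add]
        exact hbound hb (hψ _ (hσI _) x) hl0 hl
      · exact ContactFamily.preserves_of_eq_id _ fun y => by
          rw [ContactFamily.comp_toFun, hσ0 _ hneg, φ.map_zero]
    · rw [ContactFamily.energy_mul_of_deriv_eq_zero, ContactFamily.energy_comp, hd₂]
      · exact hbound ha (hφ _ (hσI _) _) hl1' hl1
      · rw [hd₁, hσd1, zero_mul]
        rwa [inv_mul_eq_div, one_le_div hl0]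
  · rw [UCont.mk_mul, φ.mk_reparam _ hβ₂ h₂0 h₂1, ψ.mk_reparam _ hβ₁ h₁0 h₁1]

end LowerBounds

/-! ### Continuity and compactness of Hamiltonians -/

section Finiteness

open Set Bundle

variable {E : Type*} [NormedAddCommGroup E] [NormedSpace ℝ E]
  {M : Type*} [TopologicalSpace M] [ChartedSpace E M] [IsManifold 𝓘(ℝ, E) ∞ M]
  {ξ : ∀ x : M, Submodule ℝ (TangentSpace 𝓘(ℝ, E) x)}
  {α : ∀ x : M, TangentSpace 𝓘(ℝ, E) x →L[ℝ] ℝ}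

/-- The velocity is the tangent map of `(t, x) ↦ φ_t (x)` applied to the continuous section `(1,
0)`. -/
theorem ContactFamily.continuous_energy
    (hα : ContMDiff (𝓘(ℝ, E).tangent) 𝓘(ℝ, ℝ) ∞
      (fun v : TangentBundle 𝓘(ℝ, E) M => α v.proj v.snd)) (φ : ContactFamily ξ ℝ) :
    Continuous (fun q : ℝ × M => φ.energy α q.1 q.2) := by
  have : IsManifold 𝓘(ℝ, E) 1 M := IsManifold.of_le (n := ∞) (by simp)
  have hsec : Continuous (fun q : ℝ × M =>
      (⟨q, ((1 : ℝ), (0 : E))⟩ : TangentBundle (𝓘(ℝ, ℝ).prod 𝓘(ℝ, E)) (ℝ × M))) := by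
    have h1 : Continuous (fun t : ℝ => (⟨t, (1 : ℝ)⟩ : TangentBundle 𝓘(ℝ, ℝ) ℝ)) :=
      (contMDiff_vectorSpace_iff_contDiff (n := 0) (V := fun _ : ℝ => (1 : ℝ))).mpr
        contDiff_const |>.continuous
    have h2 : Continuous (fun x : M => (⟨x, (0 : E)⟩ : TangentBundle 𝓘(ℝ, E) M)) :=
      (Bundle.contMDiff_zeroSection (IB := 𝓘(ℝ, E)) (n := 0) ℝ
        (TangentSpace 𝓘(ℝ, E) : M → Type _)).continuous
    exact (contMDiff_equivTangentBundleProd_symm (I := 𝓘(ℝ, ℝ)) (M := ℝ) (I' := 𝓘(ℝ, E))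
      (M' := M) (n := 0)).continuous.comp ((h1.comp continuous_fst).prodMk (h2.comp continuous_snd))
  have htan := φ.smooth_toFun.continuous_tangentMap (by simp)
  refine (hα.continuous.comp (htan.comp hsec)).congr fun q => ?_
  have h1 := mfderiv_comp_apply (I := 𝓘(ℝ, ℝ)) (I' := 𝓘(ℝ, ℝ).prod 𝓘(ℝ, E)) (I'' := 𝓘(ℝ, E)) q.1
    (g := fun q : ℝ × M => φ.toFun q.1 q.2) (f := fun s => (s, q.2))
    (φ.smooth_toFun.mdifferentiable (by simp) _)
    (mdifferentiableAt_id.prodMk mdifferentiableAt_const) (1 : ℝ)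
  have h2 : (mfderiv 𝓘(ℝ, ℝ) (𝓘(ℝ, ℝ).prod 𝓘(ℝ, E)) (fun s : ℝ => (s, q.2)) q.1 (1 : ℝ) :
      ℝ × E) = (1, 0) :=
    DFunLike.congr_fun (mfderiv_prod_left (I := 𝓘(ℝ, ℝ)) (I' := 𝓘(ℝ, E))) (1 : ℝ)
  let A : ℝ × E →L[ℝ] E := mfderiv (𝓘(ℝ, ℝ).prod 𝓘(ℝ, E)) 𝓘(ℝ, E)
    (fun q : ℝ × M => φ.toFun q.1 q.2) q
  have h3 : (φ.velocity q.1 q.2 : E) = A (1, 0) := h1.trans (congrArg A h2)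
  exact (congrArg (α (φ.toFun q.1 q.2)) h3).symm

theorem exists_hasLowerBound
    (hα : ContMDiff (𝓘(ℝ, E).tangent) 𝓘(ℝ, ℝ) ∞
      (fun v : TangentBundle 𝓘(ℝ, E) M => α v.proj v.snd)) (u : UCont ξ) :
    ∃ c, HasLowerBound α c u := by
  obtain ⟨φ, rfl⟩ := u.exists_mk
  obtain ⟨K, hK, hφK⟩ := φ.compact_support
  obtain ⟨c, hc⟩ := ((isCompact_Icc (a := (0 : ℝ)) (b := 1)).prod hK).bddBelow_image
    (φ.toContactFamily.continuous_energy hα).continuousOn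
  -- Outside `K` the energy vanishes, hence the minimum with `0`.
  refine ⟨min c 0, φ, fun t ht x => ?_, rfl⟩
  by_cases hx : x ∈ K
  · exact (min_le_left _ _).trans (hc ⟨(t, x), ⟨ht, hx⟩, rfl⟩)
  · rw [φ.toContactFamily.energy_eq_zero fun s => hφK s x hx]
    exact min_le_right _ _

/-- A positive continuous function on the compact set `[0,1] × M` is bounded away from zero. -/
theorem prec_iff [CompactSpace M] [Nonempty M]
    (hα : ContMDiff (𝓘(ℝ, E).tangent) 𝓘(ℝ, ℝ) ∞
      (fun v : TangentBundle 𝓘(ℝ, E) M => α v.proj v.snd)) {f g : UCont ξ} :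
    Prec α f g ↔ ∃ c > 0, HasLowerBound α c (g * f⁻¹) := by
  constructor
  · rintro ⟨φ, hφ, h⟩
    obtain ⟨⟨t₀, x₀⟩, ⟨ht₀, -⟩, hmin⟩ :=
      ((isCompact_Icc (a := (0 : ℝ)) (b := 1)).prod (isCompact_univ (X := M))).exists_isMinOn
        ⟨(0, Classical.arbitrary M), by simp⟩
        (φ.toContactFamily.continuous_energy hα).continuousOn
    exact ⟨_, (φ.forall_hamiltonian_iff t₀ _).mp (hφ t₀ ht₀) x₀, φ,
      fun t ht x => isMinOn_iff.mp hmin (t, x) ⟨ht, mem_univ x⟩, eq_mul_inv_of_mul_eq h⟩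
  · rintro ⟨c, hc, φ, hφ, h⟩
    exact ⟨φ, fun t ht => (φ.forall_hamiltonian_iff t _).mpr fun x => hc.trans_le (hφ t ht x),
      by rw [h, inv_mul_cancel_right]⟩

end Finiteness

/-! ### Shifting lower bounds by the Reeb flow -/

section ReebShift

open Set

variable {E : Type*} [NormedAddCommGroup E] [NormedSpace ℝ E]
  {M : Type*} [TopologicalSpace M] [ChartedSpace E M]
  {ξ : ∀ x : M, Submodule ℝ (TangentSpace 𝓘(ℝ, E) x)}
  {α : ∀ x : M, TangentSpace 𝓘(ℝ, E) x →L[ℝ] ℝ}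

/-- `ρ` is a one-parameter group of strict contactomorphisms generated by a field `X` with
`α(X) = 1`. -/
structure IsReebIsotopy (α : ∀ x : M, TangentSpace 𝓘(ℝ, E) x →L[ℝ] ℝ) (ρ : ContactIsotopy ξ) :
    Prop where
  add : ∀ s t x, ρ.toFun (s + t) x = ρ.toFun s (ρ.toFun t x)
  energy : ∀ t x, ρ.energy α t x = 1
  preserves : ∀ t x (v : TangentSpace 𝓘(ℝ, E) x),
    α (ρ.toFun t x) (mfderiv 𝓘(ℝ, E) 𝓘(ℝ, E) (ρ.toFun t) x v) = α x v

/-- The class of `s ↦ ρ_{sa}`. -/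
noncomputable def ContactIsotopy.shift (ρ : ContactIsotopy ξ) (a : ℝ) : UCont ξ :=
  UCont.mk (ρ.reparam (fun s => s * a) (by fun_prop) (by simp))

namespace IsReebIsotopy

variable {ρ : ContactIsotopy ξ}

theorem energy_comp_mul (hρ : IsReebIsotopy α ρ) (φ : ContactFamily ξ ℝ) (w : ℝ → ℝ)
    (hw : ContDiff ℝ ∞ w) (t : ℝ) (x : M) :
    (ρ.toContactFamily.comp w hw * φ).energy α t x = deriv w t + φ.energy α t x := by
  rw [ContactFamily.energy_mul_of_preserves (ρ.toContactFamily.comp w hw) φ (fun p v => hρ.preserves (w t) p v),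
    ContactFamily.energy_comp, hρ.energy, mul_one]

theorem shift_mul (hρ : IsReebIsotopy α ρ) {c : ℝ} {u : UCont ξ} (h : HasLowerBound α c u)
    (a : ℝ) : HasLowerBound α (c + a) (ρ.shift a * u) := by
  obtain ⟨φ, hφ, rfl⟩ := h
  refine ⟨ρ.reparam (fun s => s * a) (by fun_prop) (by simp) * φ, fun t ht x => ?_, rfl⟩
  refine le_of_le_of_eq ?_ (hρ.energy_comp_mul φ.toContactFamily (fun s => s * a) (by fun_prop) t x).symm
  rw [deriv_mul_const differentiableAt_id, deriv_id'', one_mul, add_comm]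
  exact add_le_add_right (hφ t ht x) a

/-- In `φ_t ρ_{ta}` the Reeb field is pushed forward by `φ_t`, which need not preserve `α`. The
homotopy `ρ_{sa(t-1)} φ_t ρ_{a(t+s(1-t))}` moves the time dependence of `ρ` to the left, where it
adds exactly `a`. -/
theorem mul_shift (hρ : IsReebIsotopy α ρ) {c : ℝ} {u : UCont ξ} (h : HasLowerBound α c u)
    (a : ℝ) : HasLowerBound α (c + a) (u * ρ.shift a) := by
  obtain ⟨φ, hφ, rfl⟩ := h
  refine ⟨⟨ρ.toContactFamily.comp (fun t => a * (t - 1)) (by fun_prop) *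
    (φ.toContactFamily * ρ.toContactFamily.comp (fun _ => a) contDiff_const), fun x => ?_⟩,
    fun t ht x => ?_, ?_⟩
  · simp [φ.map_zero, ← hρ.add, ρ.map_zero]
  · refine le_of_le_of_eq ?_ (hρ.energy_comp_mul _ _ _ t x).symm
    have hd : HasDerivAt (fun t : ℝ => a * (t - 1)) a t := by
      simpa using ((hasDerivAt_id t).sub_const 1).const_mul a
    rw [hd.deriv, ContactFamily.energy_mul_of_deriv_eq_zero _ _ contDiff_const (by simp), add_comm]
    exact add_le_add_right (hφ t ht _) a
  · refine (UCont.mk_eq_mk (φ := φ * ρ.reparam (fun s => s * a) (by fun_prop) (by simp))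
      (ρ.toContactFamily.comp (fun p : ℝ × ℝ => p.1 * (a * (p.2 - 1))) (by fun_prop) *
      (φ.toContactFamily.comp (fun p : ℝ × ℝ => p.2) (by fun_prop) *
        ρ.toContactFamily.comp (fun p : ℝ × ℝ => a * (p.2 + p.1 * (1 - p.2))) (by fun_prop)))
      (fun s x => ?_) (fun s x => ?_) (fun t x => ?_) (fun t x => ?_)).symm
    · simp only [ContactFamily.mul_toFun, ContactFamily.comp_toFun, φ.map_zero, ← hρ.add]
      rw [show s * (a * (0 - 1)) + a * (0 + s * (1 - 0)) = 0 by ring, ρ.map_zero]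
    · simp only [ContactFamily.mul_toFun, ContactFamily.comp_toFun]
      rw [show s * (a * (1 - 1)) = 0 by ring, show a * (1 + s * (1 - 1)) = 1 * a by ring,
        ρ.map_zero]
      rfl
    · simp only [ContactFamily.mul_toFun, ContactFamily.comp_toFun]
      rw [zero_mul, zero_mul, add_zero, ρ.map_zero, mul_comm a]
      rfl
    · simp

theorem shift_neg (hρ : IsReebIsotopy α ρ) (a : ℝ) : ρ.shift (-a) = (ρ.shift a)⁻¹ := by
  refine eq_inv_of_mul_eq_one_left ?_
  refine UCont.mk_eq_mk (φ := ρ.reparam (fun s => s * -a) (by fun_prop) (by simp) *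
    ρ.reparam (fun s => s * a) (by fun_prop) (by simp)) (ψ := 1) 1
    (fun _ _ => rfl) (fun _ x => ?_) (fun t x => ?_) (fun _ _ => rfl)
  · refine ((hρ.add _ _ x).symm.trans ?_).symm
    rw [show (1 : ℝ) * -a + 1 * a = 0 by ring, ρ.map_zero]
    rfl
  · refine ((hρ.add _ _ x).symm.trans ?_).symm
    rw [show t * -a + t * a = 0 by ring, ρ.map_zero]
    rfl

theorem hasLowerBound_shift_mul_iff (hρ : IsReebIsotopy α ρ) {c a : ℝ} {u : UCont ξ} :
    HasLowerBound α c (ρ.shift a * u) ↔ HasLowerBound α (c - a) u := by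
  refine ⟨fun h => ?_, fun h => by simpa using hρ.shift_mul h a⟩
  have h1 := hρ.shift_mul h (-a)
  rwa [hρ.shift_neg, inv_mul_cancel_left, ← sub_eq_add_neg] at h1

theorem hasLowerBound_mul_shift_iff (hρ : IsReebIsotopy α ρ) {c a : ℝ} {u : UCont ξ} :
    HasLowerBound α c (u * ρ.shift a) ↔ HasLowerBound α (c - a) u := by
  refine ⟨fun h => ?_, fun h => by simpa using hρ.mul_shift h a⟩
  have h1 := hρ.mul_shift h (-a)
  rwa [hρ.shift_neg, mul_inv_cancel_right, ← sub_eq_add_neg] at h1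

/-- Shifting both factors by `-s` makes the bounds negative, so concatenation applies. The shifts
sit at the outer ends of the product and can be undone without commuting with `u` or `v`. -/
theorem hasLowerBound_mul (hρ : IsReebIsotopy α ρ) {a b c : ℝ} {u v : UCont ξ}
    (hu : HasLowerBound α a u) (hv : HasLowerBound α b v) (hc : c < a + b) :
    HasLowerBound α c (u * v) := by
  set s := |a| + |b| + 1
  have h1 := (hρ.shift_mul hu (-s)).mul (hρ.mul_shift hv (-s)) (c := c + -s + -s)
    (by linarith [le_abs_self a, abs_nonneg b]) (by linarith [le_abs_self b, abs_nonneg a])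
    (by linarith)
  have h2 := hρ.mul_shift (hρ.shift_mul h1 s) s
  rw [hρ.shift_neg] at h2
  convert! h2 using 1
  · ring
  · group

end IsReebIsotopy

end ReebShift

/-! ### The Reeb isotopy on a compact manifold -/

section ReebFlow

open Set

variable {E : Type u} [NormedAddCommGroup E] [NormedSpace ℝ E] [FiniteDimensional ℝ E]
  {M : Type*} [TopologicalSpace M] [ChartedSpace E M] [IsManifold 𝓘(ℝ, E) ∞ M]
  [T2Space M] [CompactSpace M]
  {ξ : ∀ x : M, Submodule ℝ (TangentSpace 𝓘(ℝ, E) x)}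
  {α : ∀ x : M, TangentSpace 𝓘(ℝ, E) x →L[ℝ] ℝ}

theorem exists_isReebIsotopy (hα : IsContactForm ξ α) :
    ∃ ρ : ContactIsotopy ξ, IsReebIsotopy α ρ ∧ ∀ t, IsReebLift α t (ρ.shift t) := by
  obtain ⟨X, hX⟩ := exists_isReebField hα
  obtain ⟨R, hR0, hRadd, hRX, hR⟩ := exists_global_flow (contMDiff_reebField hα hX)
  have hpres := form_flow_eq hα.smooth hX hR0 hRadd hRX hR
  let ρ : ContactIsotopy ξ :=
    { toFun := R
      invFun := fun t => R (-t)
      left_inv := fun t x => by rw [← hRadd, neg_add_cancel, hR0]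
      right_inv := fun t x => by rw [← hRadd, add_neg_cancel, hR0]
      smooth_toFun := hR
      smooth_invFun :=
        hR.comp ((contDiff_neg.contMDiff.comp contMDiff_fst).prodMk contMDiff_snd)
      contact := fun t x v => by rw [hα.mem_iff, hα.mem_iff, hpres]
      compact_support := ⟨univ, isCompact_univ, fun _ x hx => absurd (mem_univ x) hx⟩
      map_zero := hR0 }
  refine ⟨ρ, ⟨hRadd, fun t x => ?_, hpres⟩, fun t =>
    ⟨X, R, _, hX, hR0, hRX, fun _ _ _ => rfl, rfl⟩⟩
  have h1 : (ρ.velocity t x : E) = X (R t x) :=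
    (DFunLike.congr_fun (hRX x t).mfderiv (1 : ℝ)).trans (one_smul ℝ _)
  exact (congrArg (α (R t x)) h1).trans (hX _).1

end ReebFlow

/-! ### Pseudo-metric axioms and naturality -/

section PseudoMetric

open Set

variable {E : Type*} [NormedAddCommGroup E] [NormedSpace ℝ E]
  {M : Type*} [TopologicalSpace M] [ChartedSpace E M]
  {ξ : ∀ x : M, Submodule ℝ (TangentSpace 𝓘(ℝ, E) x)}
  {α : ∀ x : M, TangentSpace 𝓘(ℝ, E) x →L[ℝ] ℝ}

theorem deltaMinus_eq (f₀ f₁ : UCont ξ) : deltaMinus α f₀ f₁ =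
    sInf ((fun ε : ℝ => (ε : EReal)) '' {ε : ℝ | HasLowerBound α (-ε) (f₁ * f₀⁻¹)}) := by
  have h : ∀ (φ : ContactIsotopy ξ) (t ε : ℝ),
      (∀ y, -ε ≤ φ.hamiltonian α t y) ↔ ∀ x, -ε ≤ φ.energy α t x :=
    fun φ t ε => φ.forall_hamiltonian_iff t (fun h => -ε ≤ h)
  simp only [deltaMinus, HasLowerBound, eq_mul_inv_iff_mul_eq, h]

/-- An upper bound `ε` for a class is a lower bound `-ε` for its inverse, by time reversal. -/
theorem deltaPlus_eq (f₀ f₁ : UCont ξ) : deltaPlus α f₀ f₁ = deltaMinus α f₁ f₀ := by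
  have h : ∀ (φ : ContactIsotopy ξ) (t ε : ℝ),
      (∀ y, φ.hamiltonian α t y ≤ ε) ↔ ∀ x, φ.energy α t x ≤ ε :=
    fun φ t ε => φ.forall_hamiltonian_iff t (fun h => h ≤ ε)
  simp only [deltaMinus_eq, deltaPlus, ← eq_mul_inv_iff_mul_eq, h]
  congr! with ε
  rw [← inv_inv (f₀ * f₁⁻¹), hasLowerBound_inv_iff, neg_neg, mul_inv_rev, inv_inv]

theorem dist_eq (f₀ f₁ : UCont ξ) :
    dist α f₀ f₁ = max (max (deltaMinus α f₀ f₁) (deltaMinus α f₁ f₀)) 0 := by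
  rw [dist, deltaPlus_eq]

theorem dist_comm (f₀ f₁ : UCont ξ) : dist α f₀ f₁ = dist α f₁ f₀ := by
  rw [dist_eq, dist_eq, max_comm (deltaMinus α f₀ f₁)]

theorem dist_nonneg (f₀ f₁ : UCont ξ) : 0 ≤ dist α f₀ f₁ := le_max_right _ _

theorem deltaMinus_lt_iff {f₀ f₁ : UCont ξ} {ε : ℝ} :
    deltaMinus α f₀ f₁ < ε ↔ ∃ c > -ε, HasLowerBound α c (f₁ * f₀⁻¹) := by
  rw [deltaMinus_eq, sInf_lt_iff]
  constructor
  · rintro ⟨_, ⟨c, hc, rfl⟩, h⟩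
    exact ⟨-c, neg_lt_neg (EReal.coe_lt_coe_iff.mp h), hc⟩
  · rintro ⟨c, hc, h⟩
    exact ⟨_, ⟨-c, by rwa [mem_ofPred_eq, neg_neg], rfl⟩,
      EReal.coe_lt_coe_iff.mpr (neg_lt.mp hc)⟩

theorem dist_lt_iff {f₀ f₁ : UCont ξ} {ε : ℝ} (hε : 0 < ε) :
    dist α f₀ f₁ < ε ↔ (∃ c > -ε, HasLowerBound α c (f₁ * f₀⁻¹)) ∧
      ∃ c > -ε, HasLowerBound α c (f₀ * f₁⁻¹) := by
  rw [dist_eq, max_lt_iff, max_lt_iff, deltaMinus_lt_iff, deltaMinus_lt_iff,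
    and_iff_left (by exact_mod_cast hε)]

theorem hasLowerBound_one : HasLowerBound α 0 (1 : UCont ξ) :=
  ⟨1, fun t _ _ => (ContactFamily.energy_eq_zero _ (fun _ => rfl) t).ge, rfl⟩

theorem dist_self (f : UCont ξ) : dist α f f = 0 := by
  refine le_antisymm ?_ (dist_nonneg _ _)
  refine EReal.le_of_forall_lt_iff_le.mp fun ε hε => ?_
  have hε' : 0 < ε := by exact_mod_cast hε
  refine ((dist_lt_iff hε').mpr ?_).le
  rw [mul_inv_cancel]
  exact ⟨⟨0, neg_lt_zero.mpr hε', hasLowerBound_one⟩, ⟨0, neg_lt_zero.mpr hε', hasLowerBound_one⟩⟩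

theorem dist_lt_top [IsManifold 𝓘(ℝ, E) ∞ M]
    (hα : ContMDiff (𝓘(ℝ, E).tangent) 𝓘(ℝ, ℝ) ∞
      (fun v : TangentBundle 𝓘(ℝ, E) M => α v.proj v.snd)) (f₀ f₁ : UCont ξ) :
    dist α f₀ f₁ < ⊤ := by
  obtain ⟨a, ha⟩ := exists_hasLowerBound hα (f₁ * f₀⁻¹)
  obtain ⟨b, hb⟩ := exists_hasLowerBound hα (f₀ * f₁⁻¹)
  refine ((dist_lt_iff (ε := |a| + |b| + 1) (by positivity)).mpr
    ⟨⟨a, ?_, ha⟩, ⟨b, ?_, hb⟩⟩).trans (EReal.coe_lt_top _)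
  · linarith [neg_abs_le a, abs_nonneg b]
  · linarith [neg_abs_le b, abs_nonneg a]

theorem dist_triangle [IsManifold 𝓘(ℝ, E) ∞ M]
    (hα : ContMDiff (𝓘(ℝ, E).tangent) 𝓘(ℝ, ℝ) ∞
      (fun v : TangentBundle 𝓘(ℝ, E) M => α v.proj v.snd)) (f₀ f₁ f₂ : UCont ξ) :
    dist α f₀ f₂ ≤ dist α f₀ f₁ + dist α f₁ f₂ := by
  have hreal : ∀ f g : UCont ξ, ∃ a : ℝ, 0 ≤ a ∧ dist α f g = a := fun f g => by
    lift dist α f g to ℝ using ⟨(dist_lt_top hα f g).ne,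
      (EReal.bot_lt_zero.trans_le (dist_nonneg f g)).ne'⟩ with a ha
    exact ⟨a, by exact_mod_cast ha ▸ dist_nonneg f g, rfl⟩
  obtain ⟨a, ha, hda⟩ := hreal f₀ f₁
  obtain ⟨b, hb, hdb⟩ := hreal f₁ f₂
  rw [hda, hdb]
  refine EReal.le_of_forall_lt_iff_le.mp fun z hz => ?_
  have hz' : a + b < z := by exact_mod_cast hz
  -- A third of the gap: the bounds `-(a + δ)` and `-(b + δ)` are negative even if `a` or `b` is
  -- `0`, and `5 / 2` lies strictly between the `2` copies of `δ` spent and the `3` available.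
  obtain ⟨δ, hδ, hδz⟩ : ∃ δ > 0, z = a + b + 3 * δ := ⟨(z - a - b) / 3, by linarith, by ring⟩
  obtain ⟨⟨c₁, hc₁, h₁⟩, c₂, hc₂, h₂⟩ := (dist_lt_iff (α := α) (ε := a + δ) (by linarith)).mp
    (hda.trans_lt (EReal.coe_lt_coe_iff.mpr (by linarith)))
  obtain ⟨⟨c₃, hc₃, h₃⟩, c₄, hc₄, h₄⟩ := (dist_lt_iff (α := α) (ε := b + δ) (by linarith)).mp
    (hdb.trans_lt (EReal.coe_lt_coe_iff.mpr (by linarith)))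
  refine ((dist_lt_iff (by linarith)).mpr
    ⟨⟨-(a + b + 5 / 2 * δ), by linarith, ?_⟩, ⟨-(a + b + 5 / 2 * δ), by linarith, ?_⟩⟩).le
  · have h := (h₃.mono hc₃.le).mul (h₁.mono hc₁.le) (by linarith) (by linarith)
      (c := -(a + b + 5 / 2 * δ)) (by linarith)
    rwa [mul_assoc, inv_mul_cancel_left] at h
  · have h := (h₂.mono hc₂.le).mul (h₄.mono hc₄.le) (by linarith) (by linarith)
      (c := -(a + b + 5 / 2 * δ)) (by linarith)
    rwa [mul_assoc, inv_mul_cancel_left] at h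

theorem deltaMinus_mul_left (f₀ f₁ f₂ : UCont ξ) :
    deltaMinus α (f₂ * f₀) (f₂ * f₁) = deltaMinus (pullbackForm f₂.proj α) f₀ f₁ := by
  have h : f₁ * f₀⁻¹ = f₂⁻¹ * (f₂ * f₁ * (f₂ * f₀)⁻¹) * f₂ := by group
  simp only [deltaMinus_eq, h, hasLowerBound_conj_iff]

theorem dist_mul_left (f₀ f₁ f₂ : UCont ξ) :
    dist α (f₂ * f₀) (f₂ * f₁) = dist (pullbackForm f₂.proj α) f₀ f₁ := by
  simp only [dist_eq, deltaMinus_mul_left]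

theorem dist_mul_right (f₀ f₁ f₂ : UCont ξ) : dist α (f₀ * f₂) (f₁ * f₂) = dist α f₀ f₁ := by
  have h : ∀ f g : UCont ξ, f * f₂ * (g * f₂)⁻¹ = f * g⁻¹ := fun f g => by group
  simp only [dist_eq, deltaMinus_eq, h]

/-- Right multiplication by `f` turns the pair `(f⁻¹, 1)` into `(1, f)`. -/
theorem dist_inv_one (f : UCont ξ) : dist α f⁻¹ 1 = dist α f 1 := by
  rw [← dist_mul_right f⁻¹ 1 f, inv_mul_cancel, one_mul, dist_comm]

end PseudoMetric

/-! ### Balls, intervals and the two topologies -/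

section Topologies

open Set

variable {E : Type*} [NormedAddCommGroup E] [NormedSpace ℝ E]
  {M : Type*} [TopologicalSpace M] [ChartedSpace E M] [IsManifold 𝓘(ℝ, E) ∞ M]
  [CompactSpace M] [Nonempty M]
  {ξ : ∀ x : M, Submodule ℝ (TangentSpace 𝓘(ℝ, E) x)}
  {α : ∀ x : M, TangentSpace 𝓘(ℝ, E) x →L[ℝ] ℝ}

/-- The Reeb lifts at the two ends raise both lower bounds by `ε`, so bounds above `-ε` become
positive bounds, that is, the relation `Prec`. -/
theorem ball_eq_interval
    (hα : ContMDiff (𝓘(ℝ, E).tangent) 𝓘(ℝ, ℝ) ∞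
      (fun v : TangentBundle 𝓘(ℝ, E) M => α v.proj v.snd))
    {ρ : ContactIsotopy ξ} (hρ : IsReebIsotopy α ρ) (f : UCont ξ) {ε : ℝ} (hε : 0 < ε) :
    {g | dist α f g < (ε : EReal)} = interval α (ρ.shift (-ε) * f) (ρ.shift ε * f) := by
  have hshift : ∀ u : UCont ξ, (∃ c > -ε, HasLowerBound α c u) ↔
      ∃ c > 0, HasLowerBound α (c - ε) u := fun u =>
    ⟨fun ⟨c, hc, h⟩ => ⟨c + ε, by linarith, by rwa [add_sub_cancel_right]⟩,
      fun ⟨c, hc, h⟩ => ⟨c - ε, by linarith, h⟩⟩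
  ext g
  rw [mem_ofPred_eq, dist_lt_iff hε, interval, mem_ofPred_eq, prec_iff hα, prec_iff hα, mul_inv_rev,
    ← mul_assoc, hρ.shift_neg, inv_inv, mul_assoc (ρ.shift ε)]
  simp only [hρ.hasLowerBound_mul_shift_iff, hρ.hasLowerBound_shift_mul_iff, hshift]

theorem metricTopology_eq_intervalTopology
    (hα : ContMDiff (𝓘(ℝ, E).tangent) 𝓘(ℝ, ℝ) ∞
      (fun v : TangentBundle 𝓘(ℝ, E) M => α v.proj v.snd))
    {ρ : ContactIsotopy ξ} (hρ : IsReebIsotopy α ρ) :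
    metricTopology ξ α = intervalTopology ξ α := by
  refine le_antisymm (le_generateFrom ?_) (le_generateFrom ?_)
  · rintro _ ⟨f₀, f₁, rfl⟩
    let _ := metricTopology ξ α
    refine isOpen_iff_forall_mem_open.mpr fun f hf => ?_
    obtain ⟨a, ha, hfa⟩ := (prec_iff hα).mp hf.1
    obtain ⟨b, hb, hfb⟩ := (prec_iff hα).mp hf.2
    have hm : 0 < min a b := lt_min ha hb
    -- If the interval leaves margins `a` and `b` at `f`, moving by less than `min a b / 2` leaves
    -- more than `min a b / 4`. Bounds of opposite sign are added here, which needs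
    -- `hasLowerBound_mul`.
    refine ⟨{g | dist α f g < ((min a b / 2 : ℝ) : EReal)}, fun g hg => ?_,
      TopologicalSpace.isOpen_generateFrom_of_mem ⟨f, _, half_pos hm, rfl⟩, ?_⟩
    · obtain ⟨⟨c, hc, h⟩, d, hd, h'⟩ := (dist_lt_iff (half_pos hm)).mp hg
      refine ⟨(prec_iff hα).mpr ⟨min a b / 4, by positivity, ?_⟩,
        (prec_iff hα).mpr ⟨min a b / 4, by positivity, ?_⟩⟩
      · have := hρ.hasLowerBound_mul h hfa (c := min a b / 4) (by linarith [min_le_left a b])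
        rwa [mul_assoc, inv_mul_cancel_left] at this
      · have := hρ.hasLowerBound_mul hfb h' (c := min a b / 4) (by linarith [min_le_right a b])
        rwa [mul_assoc, inv_mul_cancel_left] at this
    · rw [mem_ofPred_eq, dist_self]
      exact_mod_cast half_pos hm
  · rintro _ ⟨f, ε, hε, rfl⟩
    exact TopologicalSpace.isOpen_generateFrom_of_mem ⟨_, _, ball_eq_interval hα hρ f hε⟩

end Topologies

end ContactMetric

theorem mainTheorem6 (n : ℕ) {M : Type*} [TopologicalSpace M]
    [ChartedSpace (EuclideanSpace ℝ (Fin (2 * n + 1))) M] [IsManifold (𝓡 (2 * n + 1)) ∞ M]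
    [T2Space M] [SecondCountableTopology M] [ConnectedSpace M]
    (ξ : ∀ x : M, Submodule ℝ (TangentSpace (𝓡 (2 * n + 1)) x))
    (α : ∀ x : M, TangentSpace (𝓡 (2 * n + 1)) x →L[ℝ] ℝ)
    (hα : ContactMetric.IsContactForm ξ α) :
    -- pseudo-metric: finite, non-negative, zero on the diagonal
    (∀ f₀ f₁ : ContactMetric.UCont ξ,
      0 ≤ ContactMetric.dist α f₀ f₁ ∧ ContactMetric.dist α f₀ f₁ < ⊤) ∧
    (∀ f : ContactMetric.UCont ξ, ContactMetric.dist α f f = 0) ∧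
    -- triangle inequality
    (∀ f₀ f₁ f₂ : ContactMetric.UCont ξ,
      ContactMetric.dist α f₀ f₂ ≤ ContactMetric.dist α f₀ f₁ + ContactMetric.dist α f₁ f₂) ∧
    -- symmetry
    (∀ f₀ f₁ : ContactMetric.UCont ξ,
      ContactMetric.dist α f₀ f₁ = ContactMetric.dist α f₁ f₀) ∧
    -- left naturality
    (∀ f₀ f₁ f₂ : ContactMetric.UCont ξ,
      ContactMetric.dist α (f₂ * f₀) (f₂ * f₁) =
        ContactMetric.dist (ContactMetric.pullbackForm f₂.proj α) f₀ f₁) ∧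
    -- inverse
    (∀ f : ContactMetric.UCont ξ,
      ContactMetric.dist α f⁻¹ 1 = ContactMetric.dist α f 1) ∧
    -- right invariance
    (∀ f₀ f₁ f₂ : ContactMetric.UCont ξ,
      ContactMetric.dist α (f₀ * f₂) (f₁ * f₂) = ContactMetric.dist α f₀ f₁) ∧
    -- topology, for compact `M`; `r t` is the lift of the time-`t` Reeb flow
    (CompactSpace M →
      ContactMetric.metricTopology ξ α = ContactMetric.intervalTopology ξ α ∧
      ∃ r : ℝ → ContactMetric.UCont ξ, (∀ t, ContactMetric.IsReebLift α t (r t)) ∧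
        ∀ (f : ContactMetric.UCont ξ) (ε : ℝ), 0 < ε →
          {g : ContactMetric.UCont ξ | ContactMetric.dist α f g < (ε : EReal)} =
            ContactMetric.interval α (r (-ε) * f) (r ε * f)) := by
  refine ⟨fun f₀ f₁ => ⟨ContactMetric.dist_nonneg f₀ f₁, ContactMetric.dist_lt_top hα.smooth f₀ f₁⟩,
    ContactMetric.dist_self, ContactMetric.dist_triangle hα.smooth, ContactMetric.dist_comm,
    ContactMetric.dist_mul_left, ContactMetric.dist_inv_one, ContactMetric.dist_mul_right,
    fun _ => ?_⟩
  obtain ⟨ρ, hρ, hlift⟩ := ContactMetric.exists_isReebIsotopy hα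
  exact ⟨ContactMetric.metricTopology_eq_intervalTopology hα.smooth hρ, ρ.shift, hlift,
    fun f _ hε => ContactMetric.ball_eq_interval hα.smooth hρ f hε⟩
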